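/- **Setting.** A weighted species $\mathcal F^\omega$ assigns to each finite set $U$ a finite set $\mathcal F[U]$ of structures of size $|U|$ with weights $\omega\colon\mathcal F[U]\to\mathbb R_{\ge 0}$, and functorially to each bijection $\sigma\colon U\to V$ a weight-preserving bijection $\mathcal F[\sigma]\colon\mathcal F[U]\to\mathcal F[V]$. Write $[n]=\{1,\dots,n\}$, $\mathcal F[n]=\mathcal F[[n]]$, $\mathscr U(\mathcal F)=\bigcup_{n\ge 0}\mathcal F[n]$ (a disjoint union) and $\mathcal F^\omega(z)=\sum_{F\in\mathscr U(\mathcal F)}\omega(F)z^{|F|}/|F|!$. If $y>0$ and $0<\mathcal F^\omega(y)<\infty$, the Boltzmann distribution $\mathbb P_{\mathcal F^\omega,y}$ on $\mathscr U(\mathcal F)$ gives $F$ the probability $\mathcal F^\omega(y)^{-1}\omega(F)y^{|F|}/|F|!$. The derived species is $\mathcal F'[U]=\mathcal F[U\cup\{*\}]$ with $*\notin U$, where $*$ is not counted in the size. For a species $\mathcal G^\nu$ with $\mathcal G[\emptyset]=\emptyset$, an $(\mathcal F\circ\mathcal G)$-structure on $U$ consists of a partition $\pi$ of $U$ into non-empty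 classes, an $\mathcal F$-structure $F$ on the set $\pi$ and a $\mathcal G$-structure $G_Q$ on each $Q\in\pi$; its weight is $\omega(F)\prod_{Q\in\pi}\nu(G_Q)$. For $n\ge 1$ with $[z^n](\mathcal F^\omega\circ\mathcal G^\nu)(z)>0$ draw $\mathsf S_n=(\mathsf F_n,(\mathsf G_Q)_{Q\in\pi_n})$ from $(\mathcal F\circ\mathcal G)[n]$ with probability proportional to its weight, and choose $Q_0$ uniformly at random among the classes of $\pi_n$ of maximal size. Relabelling the atom $Q_0$ of $\mathsf F_n$ to $*$, deleting $\mathsf G_{Q_0}$, and relabelling $[n]\setminus Q_0$ increasingly by $[n-|Q_0|]$ yields the remainder $\mathsf R_n\in\mathscr U(\mathcal F'\circ\mathcal G)$. For $d\ge 1$, a power series $g(z)=\sum_n g_nz^n$ with non-negative coefficients and radius of convergence $\rho\in(0,\infty)$ belongs to $\mathscr S_d$ if $g_n=0$ whenever $d\nmid n$, $g(\rho)<\infty$, and, as $n\to\infty$ with $n\equiv 0 \bmod d$, $$\frac{g_n}{g_{n+d}}\to\rho^d,\qquad \frac1{g_n}\sum_{i+j=n}g_ig_j\to 2g(\rho).$$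 **Theorem 3.4.** Let $\mathcal F^\omega$, $\mathcal G^\nu$ be weighted species with $\mathcal G[\emptyset]=\emptyset$. Suppose that there are integers $0\le m<d$ such that $\mathcal G^\nu(z)/z^m$ is a power series in $\mathscr S_d$ with radius of convergence $\rho$, and that $\mathcal F^\omega(z)$ has radius of convergence strictly larger than $\mathcal G^\nu(\rho)$. Let $D=d/\gcd(m,d)$, let $0\le a<D$, and let $\mathcal F_a^\omega$ be the restriction of $\mathcal F^\omega$ to objects whose size lies in $a+D\mathbb Z$. If the series $\mathcal F_a^\omega(z)$ is not constant, then $0<((\mathcal F_a')^\omega\circ\mathcal G^\nu)(\rho)<\infty$, where $\mathcal F_a'=(\mathcal F_a)'$, the remainder $\mathsf R_n$ is well defined for all sufficiently large $n\equiv am \bmod d$, and $$d_{\mathrm{TV}}(\mathsf R_n,\mathsf R(a))=\sup_{\mathcal E\subset\mathscr U(\mathcal F'\circ\mathcal G)}\bigl|\mathbb P(\mathsf R_n\in\mathcal E)-\mathbb P(\mathsf R(a)\in\mathcal E)\bigr|\to 0,\qquad n\to\infty,\quad n\equiv am \bmod d,$$ where $\mathsf R(a)$ is a random $(\mathcal F_a'\circ\mathcal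 G)$-object, regarded as an element of $\mathscr U(\mathcal F'\circ\mathcal G)$, with the Boltzmann distribution $\mathbb P_{(\mathcal F_a')^\omega\circ\mathcal G^\nu,\rho}$. -/

import Mathlib

open scoped NNReal ENNReal Topology

noncomputable section

/-- A combinatorial species with non-negative weights: a functor from finite sets with bijections
to finite sets, together with an isomorphism-invariant weight. -/
structure WeightedSpecies where
  /-- The set of structures on a finite set of labels. -/
  obj : (U : Type) → [Finite U] → Type
  finite_obj : ∀ (U : Type) [Finite U], Finite (obj U)
  /-- Transport of structures along a bijection of the labels. -/
  map : ∀ {U V : Type} [Finite U] [Finite V], U ≃ V → obj U → obj V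
  map_refl : ∀ {U : Type} [Finite U] (x : obj U), map (Equiv.refl U) x = x
  map_trans : ∀ {U V W : Type} [Finite U] [Finite V] [Finite W] (σ : U ≃ V) (τ : V ≃ W)
    (x : obj U), map (σ.trans τ) x = map τ (map σ x)
  /-- The weight of a structure. -/
  weight : ∀ {U : Type} [Finite U], obj U → ℝ≥0
  weight_map : ∀ {U V : Type} [Finite U] [Finite V] (σ : U ≃ V) (x : obj U),
    weight (map σ x) = weight x

namespace WeightedSpecies

instance (F : WeightedSpecies) (U : Type) [Finite U] : Finite (F.obj U) := F.finite_obj U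

/-- All structures on the label sets `{1, …, n}`, `n ≥ 0`. -/
abbrev Universe (F : WeightedSpecies) : Type := Σ n : ℕ, F.obj (Fin n)

/-- The exponential generating series, as a formal power series. -/
def egf (F : WeightedSpecies) : PowerSeries ℝ :=
  PowerSeries.mk fun n => (∑ᶠ x : F.obj (Fin n), (F.weight x : ℝ)) / (n.factorial : ℝ)

/-- The unnormalized Boltzmann weight `ω(F) y^{|F|} / |F|!`. -/
def boltzmannWeight (F : WeightedSpecies) (y : ℝ≥0) (x : F.Universe) : ℝ≥0∞ :=
  ((F.weight x.2 * y ^ x.1 / (x.1.factorial : ℝ≥0) : ℝ≥0) : ℝ≥0∞)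

/-- The value in `[0, ∞]` of the exponential generating series at `y ≥ 0`. -/
def value (F : WeightedSpecies) (y : ℝ≥0) : ℝ≥0∞ := ∑' x : F.Universe, F.boltzmannWeight y x

/-- The Boltzmann distribution with parameter `y`, where `0 < F(y) < ∞`. -/
def boltzmann (F : WeightedSpecies) (y : ℝ≥0) (h0 : F.value y ≠ 0) (h : F.value y ≠ ∞) :
    PMF F.Universe :=
  PMF.normalize (F.boltzmannWeight y) h0 h

/-- The restriction of a species to the structures whose size lies in `a + Dℤ`. -/
def restrict (F : WeightedSpecies) (D a : ℕ) : WeightedSpecies where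
  obj U _ := {_x : F.obj U // Nat.card U ≡ a [MOD D]}
  finite_obj _ _ := inferInstance
  map σ x := ⟨F.map σ x.1, by rw [← Nat.card_congr σ]; exact x.2⟩
  map_refl x := Subtype.ext (F.map_refl x.1)
  map_trans σ τ x := Subtype.ext (F.map_trans σ τ x.1)
  weight x := F.weight x.1
  weight_map σ x := F.weight_map σ x.1

/-- The derived species; `none` plays the role of the placeholder `*`. -/
def deriv (F : WeightedSpecies) : WeightedSpecies where
  obj U _ := F.obj (Option U)
  finite_obj _ _ := inferInstance
  map σ x := F.map σ.optionCongr x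
  map_refl x := by rw [Equiv.optionCongr_refl]; exact F.map_refl x
  map_trans σ τ x := by rw [Equiv.optionCongr_trans]; exact F.map_trans _ _ x
  weight x := F.weight x
  weight_map σ x := F.weight_map _ x

/-- Partitions of a set into non-empty classes. -/
abbrev SetPartition (U : Type) : Type := {π : Set (Set U) // Setoid.IsPartition π}

/-- The partition `{σ(Q) | Q ∈ π}`; here `P = σ(Q)` is written as `σ⁻¹(P) = Q`. -/
def SetPartition.transport {U V : Type} (σ : U ≃ V) (π : SetPartition U) : SetPartition V :=
  ⟨{P | σ ⁻¹' P ∈ π.1}, by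
    refine ⟨fun h => π.2.1 (by simpa using h), fun v => ?_⟩
    obtain ⟨Q, ⟨hQ, hv⟩, huniq⟩ := π.2.2 (σ.symm v)
    refine ⟨σ.symm ⁻¹' Q, ⟨?_, hv⟩, ?_⟩
    · change σ ⁻¹' (σ.symm ⁻¹' Q) ∈ π.1
      rw [← Set.preimage_comp]
      simpa using hQ
    · rintro P ⟨hP, hvP⟩
      have h := huniq (σ ⁻¹' P) ⟨hP, by simpa using hvP⟩
      rw [← h, ← Set.preimage_comp]
      simp⟩

/-- The bijection `Q ↦ σ(Q)` between the classes of a partition and of its transport. -/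
def SetPartition.classEquiv {U V : Type} (σ : U ≃ V) (π : SetPartition U) :
    π.1 ≃ (π.transport σ).1 where
  toFun Q := ⟨σ.symm ⁻¹' Q.1, by
    change σ ⁻¹' (σ.symm ⁻¹' Q.1) ∈ π.1
    rw [← Set.preimage_comp]
    simp⟩
  invFun P := ⟨σ ⁻¹' P.1, P.2⟩
  left_inv Q := Subtype.ext (by simp [← Set.preimage_comp])
  right_inv P := Subtype.ext (by simp [← Set.preimage_comp])

/-- The restriction of a bijection `σ` to a bijection `σ⁻¹(P) → P`. -/
def preimageEquiv {U V : Type} (σ : U ≃ V) (P : Set V) : ↥(σ ⁻¹' P) ≃ ↥P :=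
  σ.subtypeEquiv fun _ => Iff.rfl

/-- The composition `F ∘ G`: a partition, an `F`-structure on its set of classes, and a
`G`-structure on each class. -/
def comp (F G : WeightedSpecies) : WeightedSpecies where
  obj U _ := Σ π : SetPartition U, F.obj π.1 × (∀ Q : π.1, G.obj Q.1)
  finite_obj _ _ := inferInstance
  map σ S := ⟨S.1.transport σ, F.map (S.1.classEquiv σ) S.2.1,
    fun P => G.map (preimageEquiv σ P.1) (S.2.2 ⟨σ ⁻¹' P.1, P.2⟩)⟩
  map_refl S := by
    obtain ⟨π, x, y⟩ := S
    refine Sigma.ext rfl (heq_of_eq (Prod.ext ?_ (funext fun P => ?_)))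
    · exact F.map_refl x
    · exact G.map_refl _
  map_trans σ τ S := by
    obtain ⟨π, x, y⟩ := S
    refine Sigma.ext rfl (heq_of_eq (Prod.ext ?_ (funext fun P => ?_)))
    · exact F.map_trans (π.classEquiv σ) ((π.transport σ).classEquiv τ) x
    · exact G.map_trans (preimageEquiv σ (τ ⁻¹' P.1)) (preimageEquiv τ P.1) _
  weight S := F.weight S.2.1 * ∏ᶠ Q, G.weight (S.2.2 Q)
  weight_map σ S := by
    obtain ⟨π, x, y⟩ := S
    dsimp only
    rw [F.weight_map]
    congr 1
    exact finprod_eq_of_bijective (π.classEquiv σ).symm (π.classEquiv σ).symm.bijective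
      fun P => G.weight_map _ _

/-- The inclusion of the `(F_a)' ∘ G`-objects into the `F' ∘ G`-objects, where `F_a` is the
restriction of `F` to sizes in `a + Dℤ`. -/
def inclusion (F G : WeightedSpecies) (D a : ℕ)
    (R : ((F.restrict D a).deriv.comp G).Universe) : (F.deriv.comp G).Universe :=
  ⟨R.1, R.2.1, R.2.2.1.1, R.2.2.2⟩

/-- The partition of the complement of the class `Q₀` into the other classes. -/
def SetPartition.erase {U : Type} (π : SetPartition U) (Q₀ : π.1) :
    SetPartition ↥(Q₀.1ᶜ) :=
  ⟨{P | Subtype.val '' P ∈ π.1}, by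
    refine ⟨fun h => π.2.1 (by simpa using h), fun v => ?_⟩
    obtain ⟨Q, ⟨hQ, hv⟩, huniq⟩ := π.2.2 v.1
    have hne : Q ≠ Q₀.1 := fun h => v.2 (h ▸ hv)
    have hsub : Q ⊆ Q₀.1ᶜ := fun u hu hu' =>
      hne ((π.2.2 u).unique ⟨hQ, hu⟩ ⟨Q₀.2, hu'⟩)
    have himg : Subtype.val '' (Subtype.val ⁻¹' Q : Set ↥(Q₀.1ᶜ)) = Q := by
      rw [Subtype.image_preimage_coe]
      exact Set.inter_eq_right.2 hsub
    refine ⟨Subtype.val ⁻¹' Q, ⟨?_, hv⟩, ?_⟩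
    · change Subtype.val '' (Subtype.val ⁻¹' Q : Set ↥(Q₀.1ᶜ)) ∈ π.1
      rwa [himg]
    · rintro P ⟨hP, hvP⟩
      have h := huniq (Subtype.val '' P) ⟨hP, ⟨v, hvP, rfl⟩⟩
      rw [← h, Set.preimage_image_eq _ Subtype.val_injective]⟩

theorem SetPartition.image_preimage_of_ne {U : Type} (π : SetPartition U) (Q₀ Q : π.1)
    (h : Q ≠ Q₀) : Subtype.val '' (Subtype.val ⁻¹' Q.1 : Set ↥(Q₀.1ᶜ)) = Q.1 := by
  rw [Subtype.image_preimage_coe]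
  exact Set.inter_eq_right.2 fun u hu hu' =>
    h (Subtype.ext ((π.2.2 u).unique ⟨Q.2, hu⟩ ⟨Q₀.2, hu'⟩))

theorem SetPartition.image_ne {U : Type} (π : SetPartition U) (Q₀ : π.1)
    (P : Set ↥(Q₀.1ᶜ)) : Subtype.val '' P ≠ Q₀.1 := by
  intro h
  obtain ⟨u, hu⟩ : Q₀.1.Nonempty :=
    Set.nonempty_iff_ne_empty.2 fun h0 => π.2.1 (h0 ▸ Q₀.2)
  have hu' := hu
  rw [← h] at hu'
  obtain ⟨v, -, rfl⟩ := hu'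
  exact v.2 hu

open Classical in
/-- The bijection from the classes of `π` to the classes other than `Q₀` together with a
placeholder: it sends `Q₀` to the placeholder and fixes every other class. -/
def SetPartition.eraseEquiv {U : Type} (π : SetPartition U) (Q₀ : π.1) :
    π.1 ≃ Option (π.erase Q₀).1 where
  toFun Q := if h : Q = Q₀ then none else
    some ⟨Subtype.val ⁻¹' Q.1, by
      change Subtype.val '' (Subtype.val ⁻¹' Q.1 : Set ↥(Q₀.1ᶜ)) ∈ π.1
      rw [π.image_preimage_of_ne Q₀ Q h]
      exact Q.2⟩
  invFun P := P.elim Q₀ fun P => ⟨Subtype.val '' P.1, P.2⟩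
  left_inv Q := by
    by_cases h : Q = Q₀
    · simp [h]
    · simp only [h, dite_false, Option.elim_some]
      exact Subtype.ext (π.image_preimage_of_ne Q₀ Q h)
  right_inv P := by
    cases P with
    | none => simp
    | some P =>
      have h : (⟨Subtype.val '' P.1, P.2⟩ : π.1) ≠ Q₀ :=
        fun h => π.image_ne Q₀ P.1 (congrArg Subtype.val h)
      refine (dif_neg h).trans (congrArg some ?_)
      apply Subtype.ext
      exact Set.preimage_image_eq P.1 Subtype.val_injective

/-- Deleting the component `Q₀` of a composite structure. -/
def eraseComponent (F G : WeightedSpecies) {U : Type} [Finite U] (S : (F.comp G).obj U)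
    (Q₀ : S.1.1) : (F.deriv.comp G).obj ↥(Q₀.1ᶜ) :=
  ⟨S.1.erase Q₀, F.map (S.1.eraseEquiv Q₀) S.2.1, fun P =>
    G.map (Equiv.Set.image Subtype.val P.1 Subtype.val_injective).symm
      (S.2.2 ⟨Subtype.val '' P.1, P.2⟩)⟩

/-- The increasing relabelling of a subset of `{1, …, n}` with `k` elements by `{1, …, k}`. -/
def increasingRelabelling {n : ℕ} (A : Set (Fin n)) : ↥A ≃ Fin (Nat.card ↥A) :=
  letI : Fintype ↥A := Fintype.ofFinite _
  (Fintype.orderIsoFinOfCardEq ↥A Nat.card_eq_fintype_card.symm).symm.toEquiv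

/-- Deleting the component `Q₀` and relabelling the remaining labels increasingly. -/
def remainder (F G : WeightedSpecies) {n : ℕ} (S : (F.comp G).obj (Fin n)) (Q₀ : S.1.1) :
    (F.deriv.comp G).Universe :=
  ⟨Nat.card ↥(Q₀.1ᶜ),
    (F.deriv.comp G).map (increasingRelabelling (Q₀.1ᶜ)) (F.eraseComponent G S Q₀)⟩

/-- The classes of maximal size of a partition. -/
def SetPartition.largest {U : Type} [Finite U] (π : SetPartition U) : Finset π.1 :=
  (Set.toFinite {Q : π.1 | ∀ Q' : π.1, Nat.card Q'.1 ≤ Nat.card Q.1}).toFinset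

theorem SetPartition.largest_nonempty {U : Type} [Finite U] [Nonempty U] (π : SetPartition U) :
    π.largest.Nonempty := by
  obtain ⟨Q, ⟨hQ, -⟩, -⟩ := π.2.2 (Classical.arbitrary U)
  have : Nonempty π.1 := ⟨⟨Q, hQ⟩⟩
  obtain ⟨Q₀, h⟩ := Finite.exists_max fun Q : π.1 => Nat.card Q.1
  exact ⟨Q₀, by simpa [SetPartition.largest] using h⟩

theorem tsum_weight_ne_zero (F : WeightedSpecies) {n : ℕ}
    (h : 0 < PowerSeries.coeff n F.egf) :
    ∑' x : F.obj (Fin n), (F.weight x : ℝ≥0∞) ≠ 0 := by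
  intro h0
  have hx : ∀ x : F.obj (Fin n), (F.weight x : ℝ) = 0 := fun x => by
    have := ENNReal.tsum_eq_zero.1 h0 x
    simpa using this
  simp [egf, hx] at h

theorem tsum_weight_ne_top (F : WeightedSpecies) (n : ℕ) :
    ∑' x : F.obj (Fin n), (F.weight x : ℝ≥0∞) ≠ ∞ := by
  let _ : Fintype (F.obj (Fin n)) := Fintype.ofFinite _
  rw [tsum_fintype]
  exact ENNReal.sum_ne_top.2 fun x _ => ENNReal.coe_ne_top

/-- The random structure on `{1, …, n}` drawn with probability proportional to its weight. -/
def sample (F : WeightedSpecies) (n : ℕ) (h : 0 < PowerSeries.coeff n F.egf) :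
    PMF (F.obj (Fin n)) :=
  PMF.normalize (fun x => (F.weight x : ℝ≥0∞)) (F.tsum_weight_ne_zero h)
    (F.tsum_weight_ne_top n)

/-- The law of the remainder `R_n`: draw a composite structure on `{1, …, n}` with probability
proportional to its weight, choose one of its largest components uniformly at random, and
delete that component. -/
def remainderLaw (F G : WeightedSpecies) (n : ℕ) (hn : 0 < n)
    (h : 0 < PowerSeries.coeff n (F.comp G).egf) : PMF (F.deriv.comp G).Universe :=
  haveI : Nonempty (Fin n) := ⟨⟨0, hn⟩⟩
  ((F.comp G).sample n h).bind fun S =>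
    (PMF.uniformOfFinset S.1.largest S.1.largest_nonempty).map (F.remainder G S)

end WeightedSpecies

/-- The total variation distance `sup_E |P(E) - Q(E)|` of two discrete distributions. -/
def dTV {α : Type} (p q : PMF α) : ℝ :=
  ⨆ E : Set α, |(p.toOuterMeasure E).toReal - (q.toOuterMeasure E).toReal|

/-- The radius of convergence of a real power series. -/
def radiusOfConvergence (g : PowerSeries ℝ) : ℝ≥0∞ :=
  (FormalMultilinearSeries.ofScalars ℝ fun n => PowerSeries.coeff n g).radius

/-- The class `𝒮_d` of power series whose coefficients form a subexponential sequence with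
span `d`; the finite number `ρ > 0` is the radius of convergence. -/
structure IsSubexponential (d : ℕ) (ρ : ℝ≥0) (g : PowerSeries ℝ) : Prop where
  one_le : 1 ≤ d
  nonneg : ∀ n, 0 ≤ PowerSeries.coeff n g
  radius_pos : 0 < ρ
  radius_eq : radiusOfConvergence g = ρ
  support : ∀ n, ¬ d ∣ n → PowerSeries.coeff n g = 0
  ratio : Filter.Tendsto
    (fun k : ℕ => PowerSeries.coeff (d * k) g / PowerSeries.coeff (d * k + d) g)
    Filter.atTop (𝓝 ((ρ : ℝ) ^ d))
  summable : Summable fun n => PowerSeries.coeff n g * (ρ : ℝ) ^ n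
  convolution : Filter.Tendsto
    (fun k : ℕ => (∑ ij ∈ Finset.HasAntidiagonal.antidiagonal (d * k),
      PowerSeries.coeff ij.1 g * PowerSeries.coeff ij.2 g) / PowerSeries.coeff (d * k) g)
    Filter.atTop (𝓝 (2 * ∑' n, PowerSeries.coeff n g * (ρ : ℝ) ^ n))

end

/-! Marking a class A of a composite structure is the same as giving an F' ∘ G-structure on the
complement of A and a G-structure on A, and weights multiply. If the remainder R has size r with 2r
< n, the deleted class holds more than half of the labels, so it is automatically the unique largest
one. Hence, exactly, P(R_n = R) = (ω(R)/r!) · [z^(n-r)]G / [z^n](F ∘ G), which is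
`toReal_remainderLaw_apply`.

It remains to find the limit of this quotient. After rescaling, G(ρz) = z^m p(z^d), where p is
subexponential with span 1, radius 1 and sum P = G(ρ) (`IsSubexponential.exists_density`). In
[z^(am+dt)](F ∘ G) only component numbers k ≡ a mod D contribute, and the k-th term involves p^k at
index t - μ⌊k/D⌋ with μ = m / gcd(m, d) (`coeff_mul_coeff_pow_lattice`). Relative to the t-th
coefficient of p, that power tends to k P^(k-1) (`tendsto_pow`). Kesten's bound
(`exists_coeff_pow_le`) and a bound on the cost of the shift (`exists_shift_le`) dominate the terms,
because F converges beyond P. Summation (`tendsto_tsum_pow`) gives the limit V = F_a'(P), the value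
of F_a' ∘ G at ρ. The numerator is a shifted coefficient of p, so the quotient tends to ρ^r / V and
the limiting probability is the Boltzmann one.

Finally, pointwise convergence to a probability distribution implies convergence in total variation,
since no mass can escape (`exists_finset_dTV_lt`). -/

noncomputable section

/-! ### Subexponential densities of span 1 and their convolution powers -/

open Filter in
/-- A summable sequence of non-negative coefficients with sum `P` that is subexponential with
span `1` and radius of convergence `1`. -/
structure IsSubexponentialDensity (p : PowerSeries ℝ) (P : ℝ) : Prop where
  nonneg : ∀ n, 0 ≤ PowerSeries.coeff n p
  hasSum : HasSum (fun n => PowerSeries.coeff n p) P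
  ratio : Tendsto (fun n => PowerSeries.coeff n p / PowerSeries.coeff (n + 1) p) atTop (𝓝 1)
  conv : Tendsto (fun n => PowerSeries.coeff n (p * p) / PowerSeries.coeff n p) atTop (𝓝 (2 * P))

theorem PowerSeries.hasSum_coeff_mul {u v : PowerSeries ℝ} {U V : ℝ}
    (hu0 : ∀ n, 0 ≤ coeff n u) (hv0 : ∀ n, 0 ≤ coeff n v)
    (hu : HasSum (fun n => coeff n u) U) (hv : HasSum (fun n => coeff n v) V) :
    HasSum (fun n => coeff n (u * v)) (U * V) := by
  have hu' : Summable fun n => ‖coeff n u‖ := by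
    simpa [Real.norm_of_nonneg (hu0 _)] using hu.summable
  have hv' : Summable fun n => ‖coeff n v‖ := by
    simpa [Real.norm_of_nonneg (hv0 _)] using hv.summable
  have h := tsum_mul_tsum_eq_tsum_sum_antidiagonal_of_summable_norm hu' hv'
  have h' := (summable_norm_sum_mul_antidiagonal_of_summable_norm hu' hv').of_norm
  rw [hu.tsum_eq, hv.tsum_eq] at h
  rw [h]
  simpa only [coeff_mul] using h'.hasSum

theorem PowerSeries.coeff_mul_nonneg {u v : PowerSeries ℝ} (hu : ∀ n, 0 ≤ coeff n u)
    (hv : ∀ n, 0 ≤ coeff n v) (n : ℕ) : 0 ≤ coeff n (u * v) := by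
  rw [coeff_mul]
  exact Finset.sum_nonneg fun i _ => mul_nonneg (hu _) (hv _)

theorem PowerSeries.coeff_pow_nonneg {u : PowerSeries ℝ} (hu : ∀ n, 0 ≤ coeff n u) (k n : ℕ) :
    0 ≤ coeff n (u ^ k) := by
  induction k generalizing n with
  | zero =>
    rw [pow_zero, coeff_one]
    split_ifs <;> norm_num
  | succ k ih =>
    rw [pow_succ]
    exact coeff_mul_nonneg ih hu n

theorem PowerSeries.hasSum_coeff_pow {u : PowerSeries ℝ} {U : ℝ} (hu0 : ∀ n, 0 ≤ coeff n u)
    (hu : HasSum (fun n => coeff n u) U) (k : ℕ) :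
    HasSum (fun n => coeff n (u ^ k)) (U ^ k) := by
  induction k with
  | zero =>
    simp only [pow_zero, coeff_one]
    exact hasSum_ite_eq 0 1
  | succ k ih =>
    rw [pow_succ, pow_succ]
    exact hasSum_coeff_mul (coeff_pow_nonneg hu0 k) hu0 ih hu

theorem PowerSeries.coeff_mul_eq_sum_range (u v : PowerSeries ℝ) (n : ℕ) :
    coeff n (u * v) = ∑ i ∈ Finset.range (n + 1), coeff i u * coeff (n - i) v := by
  rw [coeff_mul, Finset.Nat.sum_antidiagonal_eq_sum_range_succ_mk]

theorem exists_forall_lt_le (f : ℕ → ℝ) (M : ℕ) : ∃ K, ∀ n < M, f n ≤ K := by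
  obtain ⟨K, hK⟩ := ((Finset.range M).image f).exists_le
  exact ⟨K, fun n hn => hK _ (Finset.mem_image_of_mem f (Finset.mem_range.2 hn))⟩

namespace IsSubexponentialDensity

open Filter PowerSeries

variable {p : PowerSeries ℝ} {P : ℝ}

theorem eventually_pos (hp : IsSubexponentialDensity p P) : ∀ᶠ n in atTop, 0 < coeff n p := by
  filter_upwards [hp.ratio.eventually (lt_mem_nhds zero_lt_one)] with n hn
  refine lt_of_le_of_ne (hp.nonneg n) fun h => ?_
  rw [← h, zero_div] at hn
  exact lt_irrefl _ hn

theorem sum_pos (hp : IsSubexponentialDensity p P) : 0 < P := by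
  obtain ⟨n, hn⟩ := hp.eventually_pos.exists
  exact hn.trans_le (le_hasSum hp.hasSum n fun i _ => hp.nonneg i)

theorem coeff_pow_le (hp : IsSubexponentialDensity p P) (k n : ℕ) :
    coeff n (p ^ k) ≤ P ^ k :=
  le_hasSum (hasSum_coeff_pow hp.nonneg hp.hasSum k) n
    fun i _ => coeff_pow_nonneg hp.nonneg k i

/-- Telescoping: a shift by i is a product of i consecutive ratios, each tending to 1. -/
theorem tendsto_shift (hp : IsSubexponentialDensity p P) (i : ℕ) :
    Tendsto (fun n => coeff (n - i) p / coeff n p) atTop (𝓝 1) := by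
  rw [← tendsto_add_atTop_iff_nat i]
  simp only [Nat.add_sub_cancel]
  induction i with
  | zero =>
    refine tendsto_const_nhds.congr' ?_
    filter_upwards [hp.eventually_pos] with n hn
    exact (div_self hn.ne').symm
  | succ i ih =>
    have h := ih.mul (hp.ratio.comp (tendsto_add_atTop_nat i))
    rw [one_mul] at h
    refine h.congr' ?_
    filter_upwards [(tendsto_add_atTop_nat i).eventually hp.eventually_pos] with n hn
    simp only [Function.comp]
    rw [div_mul_div_cancel₀ hn.ne', add_assoc]

/-- Convolution with a sequence that is negligible compared to `p`. -/
theorem tendsto_mul_of_isLittleO (hp : IsSubexponentialDensity p P) {v : PowerSeries ℝ} {V : ℝ}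
    (hv : HasSum (fun n => coeff n v) V)
    (hvp : Tendsto (fun n => coeff n v / coeff n p) atTop (𝓝 0)) :
    Tendsto (fun n => coeff n (v * p) / coeff n p) atTop (𝓝 V) := by
  rw [Metric.tendsto_atTop']
  intro ε hε
  have hP := hp.sum_pos
  -- The error budget is δ(2P + 1) for the tail, δ for the shifted head and δ for truncating the sum
  -- of v.
  set δ := ε / (2 * P + 3) with hδdef
  have hδ : 0 < δ := by positivity
  have h1 : ∀ᶠ N in atTop, ∀ i ≥ N, |coeff i v| ≤ δ * coeff i p := by
    rw [eventually_forall_ge_atTop]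
    have h := hvp.eventually (Metric.ball_mem_nhds 0 hδ)
    filter_upwards [h, hp.eventually_pos] with i hi hpi
    rw [dist_zero_right, Real.norm_eq_abs, abs_div, abs_of_pos hpi, div_lt_iff₀ hpi] at hi
    exact hi.le
  have h2 : ∀ᶠ N in atTop, |∑ i ∈ Finset.range N, coeff i v - V| < δ :=
    (Metric.tendsto_nhds.1 hv.tendsto_sum_nat) δ hδ
  obtain ⟨N, hN1, hN2⟩ := (h1.and h2).exists
  have h3 : Tendsto (fun n => ∑ i ∈ Finset.range N, coeff i v * (coeff (n - i) p / coeff n p))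
      atTop (𝓝 (∑ i ∈ Finset.range N, coeff i v)) := by
    refine tendsto_finsetSum _ fun i _ => ?_
    simpa using (hp.tendsto_shift i).const_mul (coeff i v)
  have h4 := (Metric.tendsto_nhds.1 h3) δ hδ
  have h5 := hp.conv.eventually (gt_mem_nhds (show 2 * P < 2 * P + 1 by linarith))
  obtain ⟨M, hM⟩ := eventually_atTop.1
    (((h4.and h5).and hp.eventually_pos).and (eventually_ge_atTop N))
  refine ⟨M, fun n hn => ?_⟩
  obtain ⟨⟨⟨hn4, hn5⟩, hpos⟩, hnN⟩ := hM n hn.le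
  rw [Real.dist_eq] at hn4 ⊢
  rw [div_lt_iff₀ hpos, coeff_mul_eq_sum_range] at hn5
  have hsplit : coeff n (v * p) / coeff n p
      = ∑ i ∈ Finset.range N, coeff i v * (coeff (n - i) p / coeff n p)
        + (∑ i ∈ Finset.Ico N (n + 1), coeff i v * coeff (n - i) p) / coeff n p := by
    rw [coeff_mul_eq_sum_range,
      ← Finset.sum_range_add_sum_Ico _ (show N ≤ n + 1 by omega), add_div, Finset.sum_div]
    congr 1
    exact Finset.sum_congr rfl fun i _ => by rw [mul_div_assoc]
  have htail : |(∑ i ∈ Finset.Ico N (n + 1), coeff i v * coeff (n - i) p) / coeff n p|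
      ≤ δ * (2 * P + 1) := by
    rw [abs_div, abs_of_pos hpos, div_le_iff₀ hpos]
    calc |∑ i ∈ Finset.Ico N (n + 1), coeff i v * coeff (n - i) p|
        ≤ ∑ i ∈ Finset.Ico N (n + 1), |coeff i v * coeff (n - i) p| :=
          Finset.abs_sum_le_sum_abs _ _
      _ ≤ ∑ i ∈ Finset.Ico N (n + 1), δ * (coeff i p * coeff (n - i) p) := by
          refine Finset.sum_le_sum fun i hi => ?_
          rw [abs_mul, abs_of_nonneg (hp.nonneg (n - i)), ← mul_assoc]
          exact mul_le_mul_of_nonneg_right (hN1 i (Finset.mem_Ico.1 hi).1) (hp.nonneg _)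
      _ ≤ ∑ i ∈ Finset.range (n + 1), δ * (coeff i p * coeff (n - i) p) := by
          refine Finset.sum_le_sum_of_subset_of_nonneg (fun i hi => ?_) fun i _ _ => ?_
          · exact Finset.mem_range.2 (Finset.mem_Ico.1 hi).2
          · exact mul_nonneg hδ.le (mul_nonneg (hp.nonneg _) (hp.nonneg _))
      _ = δ * ∑ i ∈ Finset.range (n + 1), coeff i p * coeff (n - i) p := by
          rw [Finset.mul_sum]
      _ ≤ δ * ((2 * P + 1) * coeff n p) := mul_le_mul_of_nonneg_left hn5.le hδ.le
      _ = δ * (2 * P + 1) * coeff n p := by ring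
  rw [hsplit]
  have hε' : δ * (2 * P + 3) = ε := by rw [hδdef]; field_simp
  rw [abs_lt] at hN2 hn4 ⊢
  rw [abs_le] at htail
  constructor <;> nlinarith

/-- The convolution powers of a subexponential density are asymptotically proportional to it. -/
theorem tendsto_pow (hp : IsSubexponentialDensity p P) (k : ℕ) :
    Tendsto (fun n => coeff n (p ^ k) / coeff n p) atTop (𝓝 (k * P ^ (k - 1))) := by
  induction k with
  | zero =>
    simp only [pow_zero, Nat.cast_zero, zero_mul]
    refine tendsto_const_nhds.congr' ?_
    filter_upwards [eventually_gt_atTop 0] with n hn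
    rw [coeff_one, if_neg hn.ne', zero_div]
  | succ k ih =>
    -- Write p^(k+1) = (p^k - αp) p + α p². The bracket is negligible compared to p by induction, so
    -- the first product contributes its sum P^k - αP, and the second contributes 2αP.
    set α : ℝ := k * P ^ (k - 1) with hα
    have hv : HasSum (fun n => coeff n (p ^ k - C α * p)) (P ^ k - α * P) := by
      simp only [map_sub, coeff_C_mul]
      exact (hasSum_coeff_pow hp.nonneg hp.hasSum k).sub (hp.hasSum.mul_left α)
    have hvp : Tendsto (fun n => coeff n (p ^ k - C α * p) / coeff n p) atTop (𝓝 0) := by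
      have h := ih.sub_const α
      rw [sub_self] at h
      refine h.congr' ?_
      filter_upwards [hp.eventually_pos] with n hn
      rw [map_sub, coeff_C_mul, sub_div, mul_div_cancel_right₀ _ hn.ne']
    have h := (hp.tendsto_mul_of_isLittleO hv hvp).add (hp.conv.const_mul α)
    have hlim : P ^ k - α * P + α * (2 * P) = ((k + 1 : ℕ) : ℝ) * P ^ (k + 1 - 1) := by
      cases k with
      | zero => simp [hα]
      | succ j =>
        rw [hα]
        push_cast
        ring
    rw [hlim] at h
    refine h.congr fun n => ?_
    rw [sub_mul, mul_assoc, map_sub, coeff_C_mul, pow_succ]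
    ring

/-- Kesten's bound for the convolution powers of a subexponential density. -/
theorem exists_coeff_pow_le (hp : IsSubexponentialDensity p P) {ε : ℝ} (hε : 0 < ε)
    {h : ℕ → ℝ} (hpos : ∀ n, 0 < h n) (hev : ∀ᶠ n in atTop, h n = coeff n p) :
    ∃ K : ℝ, 0 < K ∧ ∀ k n, coeff n (p ^ k) ≤ K * (P + ε) ^ k * h n := by
  have hP := hp.sum_pos
  -- Removing the terms i < N from p * p leaves asymptotically less than 2P - (P - ε/4), hence less
  -- than P + ε/2. Beyond N the comparison sequence `h` agrees with p, so the induction hypothesis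
  -- becomes a bound in terms of p.
  have h1 : ∀ᶠ N in atTop, P - ε / 4 < ∑ i ∈ Finset.range N, coeff i p :=
    hp.hasSum.tendsto_sum_nat.eventually (lt_mem_nhds (by linarith))
  obtain ⟨N, hN, hNh⟩ := (h1.and (eventually_forall_ge_atTop.2 hev)).exists
  have h2 : Tendsto (fun n => ∑ i ∈ Finset.range N, coeff i p * (coeff (n - i) p / coeff n p))
      atTop (𝓝 (∑ i ∈ Finset.range N, coeff i p)) := by
    refine tendsto_finsetSum _ fun i _ => ?_
    simpa using (hp.tendsto_shift i).const_mul (coeff i p)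
  have h3 : Tendsto (fun n => ∑ i ∈ Finset.range N, (coeff (n - i) p / coeff n p))
      atTop (𝓝 N) := by
    have : Tendsto (fun n => ∑ i ∈ Finset.range N, (coeff (n - i) p / coeff n p))
      atTop (𝓝 (∑ _i ∈ Finset.range N, (1 : ℝ))) :=
      tendsto_finsetSum _ fun i _ => hp.tendsto_shift i
    simpa using this
  have h4 := (hp.conv.sub h2).eventually
    (gt_mem_nhds (show 2 * P - ∑ i ∈ Finset.range N, coeff i p < P + ε / 2 by linarith))
  have h5 := h3.eventually (gt_mem_nhds (show (N : ℝ) < N + 1 by linarith))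
  obtain ⟨M, hM⟩ := eventually_atTop.1
    (((h4.and h5).and hp.eventually_pos).and (eventually_ge_atTop N))
  obtain ⟨K₁, hK₁⟩ := exists_forall_lt_le (fun n => (h n)⁻¹) (M + 1)
  -- The first entry lets Kε/2 absorb the head i < N of the convolution. `K₁` covers the indices n ≤
  -- M, where the trivial bound P^k is used.
  set K := max (2 * (N + 1) / ε) (max K₁ 1) with hKdef
  have hK0 : 0 < K := lt_of_lt_of_le one_pos ((le_max_right _ _).trans (le_max_right _ _))
  have hKN : (N : ℝ) + 1 ≤ K * (ε / 2) := by
    have := le_max_left (2 * ((N : ℝ) + 1) / ε) (max K₁ 1)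
    rw [← hKdef, div_le_iff₀ hε] at this
    linarith
  have hsmall : ∀ n < M + 1, 1 ≤ K * h n := fun n hn => by
    have h6 : (h n)⁻¹ ≤ K :=
      (hK₁ n hn).trans ((le_max_left _ _).trans (le_max_right _ _))
    rwa [inv_le_iff_one_le_mul₀ (hpos n)] at h6
  have hsmall' : ∀ k, ∀ n < M + 1, coeff n (p ^ k) ≤ K * (P + ε) ^ k * h n := fun k n hn => by
    calc coeff n (p ^ k) ≤ P ^ k := hp.coeff_pow_le k n
      _ ≤ (P + ε) ^ k := pow_le_pow_left₀ hP.le (by linarith) k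
      _ ≤ (P + ε) ^ k * (K * h n) :=
        le_mul_of_one_le_right (pow_nonneg (by linarith) k) (hsmall n hn)
      _ = K * (P + ε) ^ k * h n := by ring
  refine ⟨K, hK0, fun k => ?_⟩
  induction k with
  | zero =>
    intro n
    rcases Nat.lt_or_ge n (M + 1) with hn | hn
    · exact hsmall' 0 n hn
    · rw [pow_zero, coeff_one, if_neg (by omega), pow_zero, mul_one]
      exact mul_nonneg hK0.le (hpos n).le
  | succ k ih =>
    intro n
    rcases Nat.lt_or_ge n (M + 1) with hn | hn
    · exact hsmall' (k + 1) n hn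
    obtain ⟨⟨⟨hn4, hn5⟩, hposn⟩, hnN⟩ := hM n (by omega)
    have hhead : ∑ i ∈ Finset.range N, coeff i (p ^ k) * coeff (n - i) p
        ≤ (P + ε) ^ k * ((N + 1) * coeff n p) := by
      rw [← Finset.sum_div, div_lt_iff₀ hposn] at hn5
      calc ∑ i ∈ Finset.range N, coeff i (p ^ k) * coeff (n - i) p
          ≤ ∑ i ∈ Finset.range N, (P + ε) ^ k * coeff (n - i) p :=
            Finset.sum_le_sum fun i _ => mul_le_mul_of_nonneg_right
              ((hp.coeff_pow_le k i).trans (pow_le_pow_left₀ hP.le (by linarith) k))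
              (hp.nonneg _)
        _ = (P + ε) ^ k * ∑ i ∈ Finset.range N, coeff (n - i) p := by rw [Finset.mul_sum]
        _ ≤ (P + ε) ^ k * ((N + 1) * coeff n p) :=
            mul_le_mul_of_nonneg_left hn5.le (pow_nonneg (by linarith) k)
    have htail : ∑ i ∈ Finset.Ico N (n + 1), coeff i (p ^ k) * coeff (n - i) p
        ≤ K * (P + ε) ^ k * ((P + ε / 2) * coeff n p) := by
      have hpp : ∑ i ∈ Finset.Ico N (n + 1), coeff i p * coeff (n - i) p
          ≤ (P + ε / 2) * coeff n p := by
        simp only [← mul_div_assoc] at hn4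
        rw [← Finset.sum_div, ← sub_div, div_lt_iff₀ hposn, coeff_mul_eq_sum_range,
          ← Finset.sum_range_add_sum_Ico _ (show N ≤ n + 1 by omega), add_sub_cancel_left] at hn4
        exact hn4.le
      calc ∑ i ∈ Finset.Ico N (n + 1), coeff i (p ^ k) * coeff (n - i) p
          ≤ ∑ i ∈ Finset.Ico N (n + 1), K * (P + ε) ^ k * (coeff i p * coeff (n - i) p) := by
            refine Finset.sum_le_sum fun i hi => ?_
            rw [← mul_assoc]
            refine mul_le_mul_of_nonneg_right ?_ (hp.nonneg _)
            rw [← hNh i (Finset.mem_Ico.1 hi).1]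
            exact ih i
        _ = K * (P + ε) ^ k * ∑ i ∈ Finset.Ico N (n + 1), coeff i p * coeff (n - i) p := by
            rw [Finset.mul_sum]
        _ ≤ K * (P + ε) ^ k * ((P + ε / 2) * coeff n p) :=
            mul_le_mul_of_nonneg_left hpp (mul_nonneg hK0.le (pow_nonneg (by linarith) k))
    rw [pow_succ, coeff_mul_eq_sum_range,
      ← Finset.sum_range_add_sum_Ico _ (show N ≤ n + 1 by omega), hNh n hnN]
    have hpe : 0 ≤ (P + ε) ^ k * coeff n p := mul_nonneg (pow_nonneg (by linarith) k) hposn.le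
    have h7 := mul_le_mul_of_nonneg_right hKN hpe
    -- The head costs at most Kε/2 and the tail K(P + ε/2), together exactly the new factor P + ε.
    calc _ ≤ (P + ε) ^ k * ((N + 1) * coeff n p) + K * (P + ε) ^ k * ((P + ε / 2) * coeff n p) :=
          add_le_add hhead htail
      _ = (N + 1) * ((P + ε) ^ k * coeff n p) + K * (P + ε) ^ k * ((P + ε / 2) * coeff n p) := by
          ring
      _ ≤ K * (ε / 2) * ((P + ε) ^ k * coeff n p)
          + K * (P + ε) ^ k * ((P + ε / 2) * coeff n p) := by linarith
      _ = K * (P + ε) ^ (k + 1) * coeff n p := by ring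

/-- A positive sequence whose consecutive ratios tend to `1` decays subexponentially. -/
theorem exists_shift_le {h : ℕ → ℝ} (hpos : ∀ n, 0 < h n)
    (hratio : Tendsto (fun n => h n / h (n + 1)) atTop (𝓝 1)) {ε : ℝ} (hε : 0 < ε) :
    ∃ K : ℝ, 0 < K ∧ ∀ s t, h t ≤ K * (1 + ε) ^ s * h (t + s) := by
  obtain ⟨M, hM⟩ := eventually_atTop.1
    (hratio.eventually (gt_mem_nhds (show (1 : ℝ) < 1 + ε by linarith)))
  have hstep : ∀ s t, M ≤ t → h t ≤ (1 + ε) ^ s * h (t + s) := by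
    intro s
    induction s with
    | zero => intro t _; simp
    | succ s ih =>
      intro t ht
      have h1 := hM (t + s) (by omega)
      rw [div_lt_iff₀ (hpos _)] at h1
      calc h t ≤ (1 + ε) ^ s * h (t + s) := ih t ht
        _ ≤ (1 + ε) ^ s * ((1 + ε) * h (t + s + 1)) :=
          mul_le_mul_of_nonneg_left h1.le (by positivity)
        _ = (1 + ε) ^ (s + 1) * h (t + (s + 1)) := by rw [pow_succ, mul_assoc, add_assoc]
  -- Up to M there is no control on ratios, so any two values are compared through a maximum of h
  -- and a maximum of 1/h.
  obtain ⟨B, hB⟩ := exists_forall_lt_le h (M + 1)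
  obtain ⟨B', hB'⟩ := exists_forall_lt_le (fun n => (h n)⁻¹) (M + 1)
  have hBB : ∀ i ≤ M, ∀ j ≤ M, h i ≤ B * B' * h j := fun i hi j hj => by
    have h1 := hB i (by omega)
    have h2 := hB' j (by omega)
    have h3 : 1 ≤ B' * h j := by rwa [inv_le_iff_one_le_mul₀ (hpos j)] at h2
    have hB0 : 0 ≤ B := (hpos i).le.trans h1
    calc h i ≤ B := h1
      _ ≤ B * (B' * h j) := le_mul_of_one_le_right hB0 h3
      _ = B * B' * h j := by ring
  refine ⟨max (B * B') 1, lt_of_lt_of_le one_pos (le_max_right _ _), fun s t => ?_⟩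
  have hone : ∀ s : ℕ, (1 : ℝ) ≤ (1 + ε) ^ s := fun s => one_le_pow₀ (by linarith)
  rcases le_or_gt M t with ht | ht
  · refine (hstep s t ht).trans (mul_le_mul_of_nonneg_right ?_ (hpos _).le)
    exact le_mul_of_one_le_left (by positivity) (le_max_right _ _)
  rcases le_or_gt (t + s) M with hts | hts
  · refine (hBB t ht.le _ hts).trans (mul_le_mul_of_nonneg_right ?_ (hpos _).le)
    exact (le_max_left _ _).trans
      (le_mul_of_one_le_right (zero_le_one.trans (le_max_right _ _)) (hone s))
  · have h1 := hstep (t + s - M) M le_rfl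
    rw [show M + (t + s - M) = t + s by omega] at h1
    have h2 : (1 + ε) ^ (t + s - M) ≤ (1 + ε) ^ s :=
      pow_le_pow_right₀ (by linarith) (by omega)
    calc h t ≤ B * B' * h M := hBB t ht.le M le_rfl
      _ ≤ max (B * B') 1 * h M := mul_le_mul_of_nonneg_right (le_max_left _ _) (hpos _).le
      _ ≤ max (B * B') 1 * ((1 + ε) ^ s * h (t + s)) := by
        refine mul_le_mul_of_nonneg_left (h1.trans ?_) (zero_le_one.trans (le_max_right _ _))
        exact mul_le_mul_of_nonneg_right h2 (hpos _).le
      _ = _ := by ring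

/-- Asymptotics of the coefficients of a composite series, with a shift growing linearly. -/
theorem tendsto_tsum_pow (hp : IsSubexponentialDensity p P) {c : ℕ → ℝ} (hc : ∀ j, 0 ≤ c j)
    {k s : ℕ → ℕ} {μ : ℕ} (hs : ∀ j, s j ≤ μ * k j) {x : ℝ} (hx : P < x)
    (hsum : Summable fun j => c j * x ^ k j) :
    Tendsto (fun t => (∑' j, c j * (if s j ≤ t then coeff (t - s j) (p ^ k j) else 0)) / coeff t p)
      atTop (𝓝 (∑' j, c j * (k j * P ^ (k j - 1)))) := by
  have hP := hp.sum_pos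
  -- The gap between P and x has to pay for Kesten's factor P + ε and for a shift of up to μ steps
  -- per component, each costing 1 + ε.
  obtain ⟨ε, hε, hεx⟩ : ∃ ε > 0, (P + ε) * (1 + ε) ^ μ < x := by
    have : Tendsto (fun ε : ℝ => (P + ε) * (1 + ε) ^ μ) (𝓝[>] 0) (𝓝 ((P + 0) * (1 + 0) ^ μ)) :=
      (Continuous.tendsto (by fun_prop) 0).mono_left nhdsWithin_le_nhds
    have h := this.eventually (gt_mem_nhds (show (P + 0) * (1 + 0) ^ μ < x by simpa using hx))
    obtain ⟨ε, h1, h2⟩ := (h.and self_mem_nhdsWithin).exists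
    exact ⟨ε, h2, h1⟩
  obtain ⟨N, hN⟩ := eventually_atTop.1 hp.eventually_pos
  -- Early coefficients may vanish; replacing them by 1 allows bounds that hold for every index.
  set h : ℕ → ℝ := fun n => if n < N then 1 else coeff n p with hh
  have hpos : ∀ n, 0 < h n := fun n => by
    rw [hh]
    dsimp only
    split_ifs with hn
    · exact one_pos
    · exact hN n (by omega)
  have hev : ∀ᶠ n in atTop, h n = coeff n p := by
    filter_upwards [eventually_ge_atTop N] with n hn
    exact if_neg (by omega)
  obtain ⟨K, hK, hpow⟩ := hp.exists_coeff_pow_le hε hpos hev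
  obtain ⟨K', hK', hshift⟩ := exists_shift_le hpos (hp.ratio.congr' (by
    filter_upwards [hev, (tendsto_add_atTop_nat 1).eventually hev] with n h1 h2
    rw [h1, h2])) hε
  simp only [← tsum_div_const]
  refine tendsto_tsum_of_dominated_convergence
    (bound := fun j => K * K' * (c j * x ^ k j)) (hsum.mul_left _) (fun j => ?_) ?_
  · have h1 := (((hp.tendsto_pow (k j)).comp (tendsto_sub_atTop_nat (s j))).mul
      (hp.tendsto_shift (s j))).const_mul (c j)
    rw [mul_one] at h1
    refine h1.congr' ?_
    filter_upwards [eventually_ge_atTop (s j),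
      (tendsto_sub_atTop_nat (s j)).eventually hp.eventually_pos] with t ht ht'
    rw [if_pos ht, Function.comp, div_mul_div_cancel₀ ht'.ne', mul_div_assoc]
  · filter_upwards [hev, hp.eventually_pos] with t ht htpos j
    rw [Real.norm_of_nonneg (div_nonneg (mul_nonneg (hc j) (by
      split_ifs
      exacts [coeff_pow_nonneg hp.nonneg _ _, le_rfl])) htpos.le), div_le_iff₀ htpos]
    have hx0 : 0 < x := hP.trans hx
    split_ifs with hst
    · have h1 := hshift (s j) (t - s j)
      rw [Nat.sub_add_cancel hst, ht] at h1
      have h2 : (1 + ε) ^ s j ≤ (1 + ε) ^ (μ * k j) :=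
        pow_le_pow_right₀ (by linarith) (hs j)
      calc c j * coeff (t - s j) (p ^ k j)
          ≤ c j * (K * (P + ε) ^ k j * (K' * (1 + ε) ^ s j * coeff t p)) :=
            mul_le_mul_of_nonneg_left ((hpow _ _).trans
              (mul_le_mul_of_nonneg_left h1 (by positivity))) (hc j)
        _ ≤ c j * (K * (P + ε) ^ k j * (K' * (1 + ε) ^ (μ * k j) * coeff t p)) := by
            have := hc j
            gcongr
        _ = K * K' * (c j * ((P + ε) * (1 + ε) ^ μ) ^ k j) * coeff t p := by
            rw [mul_pow, ← pow_mul]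
            ring
        _ ≤ K * K' * (c j * x ^ k j) * coeff t p := by
            have := hc j
            gcongr
    · rw [mul_zero]
      have := hc j
      positivity

end IsSubexponentialDensity

/-! ### Splitting a composite structure at one of its classes -/

namespace WeightedSpecies

/-- Transport of structures along a bijection is a bijection. -/
def mapEquiv (F : WeightedSpecies) {U V : Type} [Finite U] [Finite V] (σ : U ≃ V) :
    F.obj U ≃ F.obj V where
  toFun := F.map σ
  invFun := F.map σ.symm
  left_inv x := by rw [← F.map_trans, Equiv.self_trans_symm, F.map_refl]
  right_inv x := by rw [← F.map_trans, Equiv.symm_trans_self, F.map_refl]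

theorem SetPartition.nonempty_of_mem {U : Type} (π : SetPartition U) {A : Set U} (hA : A ∈ π.1) :
    A.Nonempty :=
  Set.nonempty_iff_ne_empty.2 fun h0 => π.2.1 (h0 ▸ hA)

theorem SetPartition.eq_of_mem {U : Type} (π : SetPartition U) {A B : Set U} (hA : A ∈ π.1)
    (hB : B ∈ π.1) {u : U} (huA : u ∈ A) (huB : u ∈ B) : A = B :=
  (π.2.2 u).unique ⟨hA, huA⟩ ⟨hB, huB⟩

/-- The partition of `U` obtained by adding the class `A` to a partition of its complement. -/
def SetPartition.insertClass {U : Type} {A : Set U} (hA : A.Nonempty)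
    (τ : SetPartition ↥(Aᶜ)) : SetPartition U :=
  ⟨insert A ((fun P => Subtype.val '' P) '' τ.1), by
    constructor
    · rintro (h | ⟨P, hP, h⟩)
      · exact hA.ne_empty h.symm
      · exact τ.2.1 ((Set.image_eq_empty.1 h) ▸ hP)
    · intro u
      by_cases hu : u ∈ A
      · refine ⟨A, ⟨Set.mem_insert _ _, hu⟩, ?_⟩
        rintro Q ⟨rfl | ⟨P, hP, rfl⟩, huQ⟩
        · rfl
        · obtain ⟨v, -, rfl⟩ := huQ
          exact absurd hu v.2
      · obtain ⟨P, ⟨hP, huP⟩, huniq⟩ := τ.2.2 ⟨u, hu⟩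
        refine ⟨Subtype.val '' P, ⟨Set.mem_insert_of_mem _ ⟨P, hP, rfl⟩, ⟨_, huP, rfl⟩⟩, ?_⟩
        rintro Q ⟨rfl | ⟨P', hP', rfl⟩, huQ⟩
        · exact absurd huQ hu
        · obtain ⟨v, hv, hvu⟩ := huQ
          have hv' : v = ⟨u, hu⟩ := Subtype.ext hvu
          rw [huniq P' ⟨hP', hv' ▸ hv⟩]⟩

theorem SetPartition.erase_insertClass {U : Type} {A : Set U} (hA : A.Nonempty)
    (τ : SetPartition ↥(Aᶜ)) :
    (SetPartition.insertClass hA τ).erase ⟨A, Set.mem_insert _ _⟩ = τ := by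
  apply Subtype.ext
  ext P
  change (_ = A ∨ _ ∈ _) ↔ _
  constructor
  · rintro (h | ⟨P', hP', h⟩)
    · exact absurd h ((SetPartition.insertClass hA τ).image_ne ⟨A, Set.mem_insert _ _⟩ P)
    · rwa [← Subtype.val_injective.image_injective h]
  · exact fun h => Or.inr ⟨P, h, rfl⟩

/-- Deleting the class `A` from the partitions that contain it. -/
def SetPartition.eraseClass {U : Type} (A : Set U) (π : {π : SetPartition U // A ∈ π.1}) :
    SetPartition ↥(Aᶜ) :=
  π.1.erase ⟨A, π.2⟩

/-- Every class other than A lies in the complement of A, so it is recovered from its trace there; A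
itself is known. -/
theorem SetPartition.eraseClass_injective {U : Type} {A : Set U} :
    Function.Injective (SetPartition.eraseClass A) := by
  have key : ∀ π π' : {π : SetPartition U // A ∈ π.1},
      π.1.erase ⟨A, π.2⟩ = π'.1.erase ⟨A, π'.2⟩ → π.1.1 ⊆ π'.1.1 := by
    intro π π' h Q hQ
    by_cases hQA : Q = A
    · exact hQA ▸ π'.2
    · have himg := π.1.image_preimage_of_ne ⟨A, π.2⟩ ⟨Q, hQ⟩
        fun h => hQA (congrArg Subtype.val h)
      have h1 : (Subtype.val ⁻¹' Q : Set ↥(Aᶜ)) ∈ (π.1.erase ⟨A, π.2⟩).1 := by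
        change Subtype.val '' (Subtype.val ⁻¹' Q : Set ↥(Aᶜ)) ∈ π.1.1
        rw [himg]
        exact hQ
      rw [h] at h1
      change Subtype.val '' (Subtype.val ⁻¹' Q : Set ↥(Aᶜ)) ∈ π'.1.1 at h1
      rwa [himg] at h1
  exact fun π π' h => Subtype.ext (Subtype.ext ((key π π' h).antisymm (key π' π h.symm)))

theorem SetPartition.eraseClass_bijective {U : Type} {A : Set U} (hA : A.Nonempty) :
    Function.Bijective (SetPartition.eraseClass A) :=
  ⟨SetPartition.eraseClass_injective, fun τ =>
    ⟨⟨SetPartition.insertClass hA τ, Set.mem_insert _ _⟩, SetPartition.erase_insertClass hA τ⟩⟩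

/-- Splitting the structure carried by a partition at one of its classes. -/
def splitFiber (F G : WeightedSpecies) {U : Type} [Finite U] {A : Set U} (π : SetPartition U)
    (hA : A ∈ π.1) (z : F.obj π.1 × (∀ Q : π.1, G.obj Q.1)) :
    (F.obj (Option (π.erase ⟨A, hA⟩).1) × ∀ P : (π.erase ⟨A, hA⟩).1, G.obj P.1) × G.obj A :=
  ((F.map (π.eraseEquiv ⟨A, hA⟩) z.1, fun P =>
    G.map (Equiv.Set.image Subtype.val P.1 Subtype.val_injective).symm
      (z.2 ⟨Subtype.val '' P.1, P.2⟩)), z.2 ⟨A, hA⟩)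

theorem splitFiber_bijective (F G : WeightedSpecies) {U : Type} [Finite U] {A : Set U}
    (π : SetPartition U) (hA : A ∈ π.1) : Function.Bijective (splitFiber F G π hA) := by
  set e := π.eraseEquiv ⟨A, hA⟩ with he
  constructor
  · rintro ⟨x, y⟩ ⟨x', y'⟩ h
    have h1 := (F.mapEquiv e).injective (congrArg (fun z => z.1.1) h)
    have h2 := congrArg (fun z => z.1.2) h
    have h3 : y ⟨A, hA⟩ = y' ⟨A, hA⟩ := congrArg (fun z => z.2) h
    refine Prod.ext h1 (funext fun Q => ?_)
    obtain ⟨o, rfl⟩ := e.symm.surjective Q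
    cases o with
    | none => exact h3
    | some P => exact (G.mapEquiv _).injective (congrFun h2 P)
  · rintro ⟨⟨x, y⟩, z⟩
    -- The family is prescribed over `Option`, with `none` standing for A, and then carried to the
    -- classes of π along `e.symm`.
    let w : ∀ o, G.obj (e.symm o).1 := fun o =>
      match o with
      | none => z
      | some P => G.map (Equiv.Set.image Subtype.val P.1 Subtype.val_injective) (y P)
    refine ⟨(F.map e.symm x, Equiv.piCongrLeft (fun Q : π.1 => G.obj Q.1) e.symm w), ?_⟩
    have hw : ∀ o, Equiv.piCongrLeft (fun Q : π.1 => G.obj Q.1) e.symm w (e.symm o) = w o :=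
      Equiv.piCongrLeft_apply_apply _ _ _
    refine Prod.ext (Prod.ext ((F.mapEquiv e).apply_symm_apply x) (funext fun P => ?_)) ?_
    · refine (congrArg (G.map _) (hw (some P))).trans ?_
      exact (G.mapEquiv _).symm_apply_apply (y P)
    · exact hw none

theorem weight_splitFiber (F G : WeightedSpecies) {U : Type} [Finite U] {A : Set U}
    (π : SetPartition U) (hA : A ∈ π.1) (z : F.obj π.1 × (∀ Q : π.1, G.obj Q.1)) :
    F.weight z.1 * ∏ᶠ Q, G.weight (z.2 Q) =
      F.weight (splitFiber F G π hA z).1.1 * (∏ᶠ P, G.weight ((splitFiber F G π hA z).1.2 P))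
        * G.weight (splitFiber F G π hA z).2 := by
  let _ : Fintype (π.erase ⟨A, hA⟩).1 := Fintype.ofFinite _
  simp only [splitFiber, F.weight_map, G.weight_map]
  rw [mul_assoc]
  congr 1
  rw [← finprod_comp (g := fun Q => G.weight (z.2 Q)) _
    (π.eraseEquiv ⟨A, hA⟩).symm.bijective, finprod_eq_prod_of_fintype,
    Fintype.prod_option, finprod_eq_prod_of_fintype, mul_comm]
  rfl

/-- Splitting off the component carried by `A`. -/
def split (F G : WeightedSpecies) {U : Type} [Finite U] (A : Set U)
    (S : {S : (F.comp G).obj U // A ∈ S.1.1}) : (F.deriv.comp G).obj ↥(Aᶜ) × G.obj A :=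
  (F.eraseComponent G S.1 ⟨A, S.2⟩, S.1.2.2 ⟨A, S.2⟩)

/-- The structures live over the partition, so the bijection is assembled as a map of sigma types:
bijective on the base (erasing A) and on every fibre. -/
theorem split_bijective (F G : WeightedSpecies) {U : Type} [Finite U] {A : Set U}
    (hA : A.Nonempty) : Function.Bijective (F.split G A) := by
  let f : (Σ π : {π : SetPartition U // A ∈ π.1}, F.obj π.1.1 × (∀ Q : π.1.1, G.obj Q.1)) →
      Σ τ : SetPartition ↥(Aᶜ), (F.obj (Option τ.1) × ∀ P : τ.1, G.obj P.1) × G.obj A :=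
    Sigma.map (SetPartition.eraseClass A) fun π => splitFiber F G π.1 π.2
  have hf : Function.Bijective f :=
    ⟨SetPartition.eraseClass_injective.sigma_map fun π => (splitFiber_bijective F G π.1 π.2).1,
      (SetPartition.eraseClass_bijective hA).2.sigma_map
        fun π => (splitFiber_bijective F G π.1 π.2).2⟩
  let e₁ : {S : (F.comp G).obj U // A ∈ S.1.1} ≃
      Σ π : {π : SetPartition U // A ∈ π.1}, F.obj π.1.1 × (∀ Q : π.1.1, G.obj Q.1) :=
    { toFun := fun S => ⟨⟨S.1.1, S.2⟩, S.1.2⟩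
      invFun := fun S => ⟨⟨S.1.1, S.2⟩, S.1.2⟩
      left_inv := fun _ => rfl
      right_inv := fun _ => rfl }
  let e₂ : (Σ τ : SetPartition ↥(Aᶜ),
      (F.obj (Option τ.1) × ∀ P : τ.1, G.obj P.1) × G.obj A) ≃
      (F.deriv.comp G).obj ↥(Aᶜ) × G.obj A :=
    { toFun := fun S => (⟨S.1, S.2.1⟩, S.2.2)
      invFun := fun S => ⟨S.1.1, S.1.2, S.2⟩
      left_inv := fun _ => rfl
      right_inv := fun _ => rfl }
  exact (e₂.bijective.comp hf).comp e₁.bijective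

theorem weight_split (F G : WeightedSpecies) {U : Type} [Finite U] {A : Set U}
    (S : {S : (F.comp G).obj U // A ∈ S.1.1}) :
    (F.comp G).weight S.1
      = (F.deriv.comp G).weight (F.split G A S).1 * G.weight (F.split G A S).2 :=
  weight_splitFiber F G S.1.1 S.2 S.1.2

/-! ### Weighted enumeration by number of components -/

/-- The total weight of the structures on `{1, …, n}`. -/
def mass (F : WeightedSpecies) (n : ℕ) : ℝ≥0 := ∑' x : F.obj (Fin n), F.weight x

theorem coe_mass (F : WeightedSpecies) (n : ℕ) :
    (F.mass n : ℝ≥0∞) = ∑' x : F.obj (Fin n), (F.weight x : ℝ≥0∞) := by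
  let _ := Fintype.ofFinite (F.obj (Fin n))
  rw [mass, tsum_fintype, tsum_fintype, ENNReal.ofNNReal_finsetSum]

theorem tsum_weight (F : WeightedSpecies) {U : Type} [Finite U] :
    ∑' x : F.obj U, (F.weight x : ℝ≥0∞) = F.mass (Nat.card U) := by
  rw [coe_mass, ← (F.mapEquiv (Finite.equivFin U)).tsum_eq]
  exact tsum_congr fun x => by rw [← F.weight_map (Finite.equivFin U) x]; rfl

theorem coeff_egf (F : WeightedSpecies) (n : ℕ) :
    PowerSeries.coeff n F.egf = F.mass n / n.factorial := by
  let _ := Fintype.ofFinite (F.obj (Fin n))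
  rw [egf, PowerSeries.coeff_mk, mass, tsum_fintype, finsum_eq_sum_of_fintype, NNReal.coe_sum]

theorem mass_deriv (F : WeightedSpecies) (n : ℕ) : F.deriv.mass n = F.mass (n + 1) := by
  have h : (F.deriv.mass n : ℝ≥0∞) = F.mass (n + 1) := by
    rw [coe_mass]
    refine (F.tsum_weight (U := Option (Fin n))).trans ?_
    rw [Finite.card_option, Nat.card_fin]
  exact_mod_cast h

theorem sum_set_apply_card_compl {n : ℕ} (f : ℕ → ℝ≥0∞) :
    ∑' A : Set (Fin n), f (Nat.card ↥(Aᶜ))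
      = ∑ r ∈ Finset.range (n + 1), (n.choose r : ℝ≥0∞) * f r := by
  classical
  rw [← (compl_involutive (α := Set (Fin n))).toPerm.tsum_eq, ← (Fintype.finsetEquivSet (α := Fin n)).tsum_eq,
    tsum_fintype]
  have h := Finset.sum_powerset_apply_card f (x := (Finset.univ : Finset (Fin n)))
  rw [Finset.powerset_univ, Finset.card_univ, Fintype.card_fin] at h
  simp only [nsmul_eq_mul] at h
  rw [← h]
  refine Finset.sum_congr rfl fun A _ => ?_
  congr 1
  simp

/-- Summing over the components of composite structures: each structure with a distinguished
component is obtained from a structure of `F' ∘ G` and a structure of `G`. -/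
theorem tsum_remainder (F G : WeightedSpecies) [hG : IsEmpty (G.obj (Fin 0))] (n : ℕ)
    (φ : (F.deriv.comp G).Universe → ℝ≥0∞) :
    ∑' S : (F.comp G).obj (Fin n), ∑' Q : S.1.1,
        ((F.comp G).weight S : ℝ≥0∞) * φ (F.remainder G S Q)
      = ∑ r ∈ Finset.range (n + 1), (n.choose r : ℝ≥0∞) *
          (G.mass (n - r) * ∑' R : (F.deriv.comp G).obj (Fin r),
            ((F.deriv.comp G).weight R : ℝ≥0∞) * φ ⟨r, R⟩) := by
  rw [← sum_set_apply_card_compl (fun r => (G.mass (n - r) : ℝ≥0∞) *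
    ∑' R : (F.deriv.comp G).obj (Fin r), ((F.deriv.comp G).weight R : ℝ≥0∞) * φ ⟨r, R⟩)]
  let e : (Σ A : Set (Fin n), {S : (F.comp G).obj (Fin n) // A ∈ S.1.1}) ≃
      Σ S : (F.comp G).obj (Fin n), S.1.1 :=
    { toFun := fun x => ⟨x.2.1, x.1, x.2.2⟩
      invFun := fun x => ⟨x.2.1, x.1, x.2.2⟩
      left_inv := fun _ => rfl
      right_inv := fun _ => rfl }
  rw [← ENNReal.tsum_sigma' (fun x : Σ S : (F.comp G).obj (Fin n), S.1.1 =>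
    ((F.comp G).weight x.1 : ℝ≥0∞) * φ (F.remainder G x.1 x.2)), ← e.tsum_eq,
    ENNReal.tsum_sigma']
  refine tsum_congr fun A => ?_
  have hcard : n - Nat.card ↥(Aᶜ) = Nat.card A := by
    have := Nat.card_coe_set_eq A ▸ Nat.card_coe_set_eq Aᶜ ▸ Set.ncard_add_ncard_compl A
    rw [Nat.card_fin] at this
    omega
  -- The empty set is never a class. Its term on the other side vanishes because G has no structure
  -- of size 0.
  rcases A.eq_empty_or_nonempty with rfl | hA
  · have h1 : IsEmpty {S : (F.comp G).obj (Fin n) // ∅ ∈ S.1.1} := ⟨fun S => S.1.1.2.1 S.2⟩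
    have h2 : G.mass 0 = 0 := by simp [mass]
    rw [tsum_empty, hcard]
    simp [h2]
  have hval : ∀ S : {S : (F.comp G).obj (Fin n) // A ∈ S.1.1},
      ((F.comp G).weight S.1 : ℝ≥0∞) * φ (F.remainder G S.1 ⟨A, S.2⟩)
      = (fun z : (F.deriv.comp G).obj ↥(Aᶜ) × G.obj A =>
        ((F.deriv.comp G).weight z.1 : ℝ≥0∞) * (G.weight z.2 : ℝ≥0∞) *
        φ ⟨_, (F.deriv.comp G).map (increasingRelabelling (Aᶜ)) z.1⟩) (F.split G A S) := fun S => by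
    rw [weight_split, ENNReal.coe_mul]
    rfl
  calc _ = ∑' z : (F.deriv.comp G).obj ↥(Aᶜ) × G.obj A,
        ((F.deriv.comp G).weight z.1 : ℝ≥0∞) * (G.weight z.2 : ℝ≥0∞) *
        φ ⟨_, (F.deriv.comp G).map (increasingRelabelling (Aᶜ)) z.1⟩ := by
        rw [← (Equiv.ofBijective _ (F.split_bijective G hA)).tsum_eq]
        exact tsum_congr hval
    _ = ∑' R : (F.deriv.comp G).obj ↥(Aᶜ), (G.mass (n - Nat.card ↥(Aᶜ)) : ℝ≥0∞) *
        (((F.deriv.comp G).weight R : ℝ≥0∞) *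
        φ ⟨_, (F.deriv.comp G).map (increasingRelabelling (Aᶜ)) R⟩) := by
        rw [ENNReal.tsum_prod']
        refine tsum_congr fun R => ?_
        dsimp only
        rw [ENNReal.tsum_mul_right, ENNReal.tsum_mul_left, tsum_weight, hcard]
        ring
    _ = _ := by
        rw [ENNReal.tsum_mul_left]
        congr 1
        rw [← ((F.deriv.comp G).mapEquiv (increasingRelabelling (Aᶜ))).tsum_eq]
        refine tsum_congr fun R => ?_
        congr 2
        exact ((F.deriv.comp G).weight_map _ R).symm

theorem card_remainder (F G : WeightedSpecies) {n : ℕ} (S : (F.comp G).obj (Fin n)) (Q : S.1.1) :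
    Nat.card S.1.1 = Nat.card (F.remainder G S Q).2.1.1 + 1 := by
  rw [Nat.card_congr (S.1.eraseEquiv Q), Finite.card_option]
  congr 1
  exact Nat.card_congr (SetPartition.classEquiv _ _)

open Classical in
/-- The total weight of the composite structures on `{1, …, n}` with `k` components. -/
def compMass (F G : WeightedSpecies) (k n : ℕ) : ℝ≥0∞ :=
  ∑' S : (F.comp G).obj (Fin n),
    if Nat.card S.1.1 = k then ((F.comp G).weight S : ℝ≥0∞) else 0

theorem tsum_compMass (F G : WeightedSpecies) (n : ℕ) :
    ∑' k, F.compMass G k n = (F.comp G).mass n := by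
  rw [coe_mass]
  simp only [compMass]
  rw [ENNReal.tsum_comm]
  exact tsum_congr fun S => tsum_ite_eq' _ _

/-- Double counting of a distinguished class: there are k + 1 choices, and deleting it leaves an F'
∘ G-structure with k classes. -/
theorem compMass_succ (F G : WeightedSpecies) [IsEmpty (G.obj (Fin 0))] (k n : ℕ) :
    ((k + 1 : ℕ) : ℝ≥0∞) * F.compMass G (k + 1) n
      = ∑ r ∈ Finset.range (n + 1), (n.choose r : ℝ≥0∞) *
          (G.mass (n - r) * F.deriv.compMass G k r) := by
  classical
  have h := F.tsum_remainder G n fun R => if Nat.card R.2.1.1 = k then 1 else 0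
  simp only [mul_ite, mul_one, mul_zero] at h
  rw [compMass, ← ENNReal.tsum_mul_left]
  refine Eq.trans ?_ (h.trans ?_)
  · refine tsum_congr fun S => ?_
    let _ := Fintype.ofFinite S.1.1
    have h1 : ∀ Q : S.1.1, (Nat.card (F.remainder G S Q).2.1.1 = k) ↔ Nat.card S.1.1 = k + 1 :=
      fun Q => by rw [F.card_remainder G S Q, Nat.add_right_cancel_iff]
    simp only [h1, tsum_fintype, Finset.sum_const, Finset.card_univ, nsmul_eq_mul]
    rw [← Nat.card_eq_fintype_card]
    split_ifs with h2
    · rw [h2]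
    · simp
  · rfl

theorem compMass_zero (F G : WeightedSpecies) (n : ℕ) :
    F.compMass G 0 n = if n = 0 then (F.mass 0 : ℝ≥0∞) else 0 := by
  classical
  split_ifs with hn
  · subst hn
    have hempty : ∀ π : SetPartition (Fin 0), IsEmpty π.1 := fun π =>
      ⟨fun Q => (π.nonempty_of_mem Q.2).elim fun u _ => u.elim0⟩
    let π₀ : SetPartition (Fin 0) := ⟨∅, fun h => h, fun u => u.elim0⟩
    let _ : Unique (SetPartition (Fin 0)) := ⟨⟨π₀⟩, fun π =>
      Subtype.ext (Set.isEmpty_coe_sort.1 (hempty π))⟩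
    have h1 : ∀ S : (F.comp G).obj (Fin 0),
        (if Nat.card S.1.1 = 0 then ((F.comp G).weight S : ℝ≥0∞) else 0)
          = (F.weight S.2.1 : ℝ≥0∞) := fun S => by
      have := hempty S.1
      rw [if_pos Nat.card_of_isEmpty]
      change ((F.weight S.2.1 * ∏ᶠ Q, G.weight (S.2.2 Q) : ℝ≥0) : ℝ≥0∞) = _
      rw [finprod_of_isEmpty, mul_one]
    have := hempty default
    rw [compMass, tsum_congr h1]
    refine (ENNReal.tsum_sigma' (β := fun π : SetPartition (Fin 0) =>
      F.obj π.1 × (∀ Q : π.1, G.obj Q.1)) fun S => (F.weight S.2.1 : ℝ≥0∞)).trans ?_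
    rw [tsum_eq_single default fun π hπ => absurd (Subsingleton.elim π default) hπ,
      ENNReal.tsum_prod']
    simp only [tsum_fintype, Finset.univ_unique, Finset.sum_singleton]
    rw [tsum_weight, Nat.card_of_isEmpty]
  · rw [compMass, ENNReal.tsum_eq_zero]
    intro S
    have : Nonempty (Fin n) := ⟨⟨0, Nat.pos_of_ne_zero hn⟩⟩
    have : Nonempty S.1.1 := ⟨S.1.largest_nonempty.choose⟩
    exact if_neg Nat.card_pos.ne'

/-- The series of `G` with coefficients in `ℝ≥0`. -/
def egfNN (G : WeightedSpecies) : PowerSeries ℝ≥0 :=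
  PowerSeries.mk fun n => G.mass n / n.factorial

theorem coeff_egfNN (G : WeightedSpecies) (n : ℕ) :
    PowerSeries.coeff n G.egfNN = G.mass n / n.factorial :=
  PowerSeries.coeff_mk _ _

theorem map_egfNN (G : WeightedSpecies) :
    PowerSeries.map NNReal.toRealHom G.egfNN = G.egf := by
  ext n
  rw [PowerSeries.coeff_map, coeff_egfNN, coeff_egf]
  simp

/-- The coefficients of the composite series, according to the number of components. -/
theorem factorial_mul_compMass (F G : WeightedSpecies) [IsEmpty (G.obj (Fin 0))] (k n : ℕ) :
    (k.factorial : ℝ≥0∞) * F.compMass G k n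
      = ((n.factorial * (F.mass k * PowerSeries.coeff n (G.egfNN ^ k)) : ℝ≥0) : ℝ≥0∞) := by
  -- The species must vary in the induction, since deleting a component turns F into F'.
  induction k generalizing F n with
  | zero =>
    rw [pow_zero, PowerSeries.coeff_one, Nat.factorial_zero, Nat.cast_one, one_mul,
      compMass_zero]
    split_ifs with hn <;> simp [hn]
  | succ k ih =>
    rw [Nat.factorial_succ, Nat.cast_mul, mul_comm ((k + 1 : ℕ) : ℝ≥0∞), mul_assoc,
      compMass_succ, Finset.mul_sum, pow_succ, PowerSeries.coeff_mul,
      Finset.Nat.sum_antidiagonal_eq_sum_range_succ_mk, Finset.mul_sum, Finset.mul_sum,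
      ENNReal.ofNNReal_finsetSum]
    refine Finset.sum_congr rfl fun r hr => ?_
    have hr' : r ≤ n := Nat.lt_succ_iff.1 (Finset.mem_range.1 hr)
    calc (k.factorial : ℝ≥0∞) * ((n.choose r : ℝ≥0∞) * (G.mass (n - r) * F.deriv.compMass G k r))
        = (n.choose r : ℝ≥0∞) * G.mass (n - r) * (k.factorial * F.deriv.compMass G k r) := by ring
      _ = _ := by
        rw [ih, mass_deriv]
        norm_cast
        rw [← Nat.choose_mul_factorial_mul_factorial hr', coeff_egfNN]
        have : ((n - r).factorial : ℝ≥0) ≠ 0 := Nat.cast_ne_zero.2 (Nat.factorial_ne_zero _)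
        push_cast
        field_simp

end WeightedSpecies

/-! ### Total variation from pointwise lower bounds -/

theorem PMF.hasSum_toReal {α : Type} (p : PMF α) : HasSum (fun x => (p x).toReal) 1 := by
  have h := ENNReal.hasSum_toReal p.tsum_coe_ne_top
  rwa [← ENNReal.tsum_toReal_eq p.apply_ne_top, p.tsum_coe, ENNReal.toReal_one] at h

theorem PMF.toReal_toOuterMeasure {α : Type} (p : PMF α) (E : Set α) :
    (p.toOuterMeasure E).toReal = ∑' x, E.indicator (fun x => (p x).toReal) x := by
  classical
  rw [p.toOuterMeasure_apply, ENNReal.tsum_toReal_eq]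
  · refine tsum_congr fun x => ?_
    by_cases hx : x ∈ E <;> simp [hx]
  · intro x
    by_cases hx : x ∈ E <;> simp [hx, p.apply_ne_top]

theorem PMF.toReal_toOuterMeasure_compl {α : Type} (p : PMF α) (E : Set α) :
    (p.toOuterMeasure Eᶜ).toReal = 1 - (p.toOuterMeasure E).toReal := by
  have h := p.hasSum_toReal
  rw [p.toReal_toOuterMeasure, p.toReal_toOuterMeasure, eq_sub_iff_add_eq', ← h.tsum_eq,
    ← (h.summable.indicator E).tsum_add (h.summable.indicator Eᶜ)]
  exact tsum_congr fun x => Set.indicator_self_add_compl_apply E _ x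

/-- Two discrete distributions are close in total variation as soon as one almost dominates the
other on a suitable finite set. -/
theorem exists_finset_dTV_lt {α : Type} (q : PMF α) {ε : ℝ} (hε : 0 < ε) :
    ∃ s : Finset α, (∀ x ∈ s, q x ≠ 0) ∧ ∃ δ > 0, ∀ p : PMF α,
      (∀ x ∈ s, (q x).toReal - δ ≤ (p x).toReal) → dTV p q < ε := by
  classical
  have hq := q.hasSum_toReal
  obtain ⟨s₀, hs₀⟩ := (hq.eventually (lt_mem_nhds (show 1 - ε / 3 < 1 by linarith))).exists
  -- Only atoms of q are kept, so every point of s has positive limiting probability.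
  set s := s₀.filter fun x => q x ≠ 0 with hs
  have hsum : 1 - ε / 3 < ∑ x ∈ s, (q x).toReal := by
    rw [hs, Finset.sum_filter_of_ne]
    · exact hs₀
    · intro x _ hx h0
      exact hx (by rw [h0, ENNReal.toReal_zero])
  -- The deficits on s add up to at most ε/3; the + 1 covers an empty s.
  refine ⟨s, fun x hx => (Finset.mem_filter.1 hx).2, ε / (3 * (s.card + 1)), by positivity,
    fun p hp => ?_⟩
  have hpq := p.hasSum_toReal
  have key : ∀ E : Set α,
      (q.toOuterMeasure E).toReal - (p.toOuterMeasure E).toReal ≤ 2 * ε / 3 := by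
    intro E
    have hsE : ∀ r : PMF α, (r.toOuterMeasure E).toReal
        = ∑ x ∈ s, E.indicator (fun x => (r x).toReal) x
          + ∑' x : {x // x ∉ s}, E.indicator (fun x => (r x).toReal) x := fun r => by
      rw [r.toReal_toOuterMeasure]
      exact ((r.hasSum_toReal.summable.indicator E).sum_add_tsum_subtype_compl s).symm
    have htail : ∑' x : {x // x ∉ s}, E.indicator (fun x => (q x).toReal) x ≤ ε / 3 := by
      have h1 : ∑' x : {x // x ∉ s}, E.indicator (fun x => (q x).toReal) x
          ≤ ∑' x : {x // x ∉ s}, (q x).toReal :=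
        ((hq.summable.indicator E).subtype _).tsum_le_tsum
          (fun x => Set.indicator_le_self' (fun _ _ => ENNReal.toReal_nonneg) _)
          (hq.summable.subtype _)
      have h2 := hq.summable.sum_add_tsum_subtype_compl s
      rw [hq.tsum_eq] at h2
      linarith
    have htail' : 0 ≤ ∑' x : {x // x ∉ s}, E.indicator (fun x => (p x).toReal) x :=
      tsum_nonneg fun x => Set.indicator_nonneg (fun _ _ => ENNReal.toReal_nonneg) _
    have hhead : ∑ x ∈ s, E.indicator (fun x => (q x).toReal) x
        - ∑ x ∈ s, E.indicator (fun x => (p x).toReal) x ≤ ε / 3 := by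
      rw [← Finset.sum_sub_distrib]
      calc _ ≤ ∑ x ∈ s, ε / (3 * (s.card + 1)) := by
            refine Finset.sum_le_sum fun x hx => ?_
            by_cases hxE : x ∈ E
            · have := hp x hx
              simp only [hxE, Set.indicator_of_mem]
              linarith
            · simp only [hxE, not_false_eq_true, Set.indicator_of_notMem, sub_zero]
              positivity
        _ = s.card * (ε / (3 * (s.card + 1))) := by rw [Finset.sum_const, nsmul_eq_mul]
        _ ≤ (s.card + 1) * (ε / (3 * (s.card + 1))) := by gcongr; linarith
        _ = ε / 3 := by field_simp
    rw [hsE q, hsE p]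
    linarith
  have hle : dTV p q ≤ 2 * ε / 3 := by
    refine ciSup_le fun E => abs_le.2 ⟨?_, ?_⟩
    · linarith [key E]
    -- Both total masses are 1, so the one-sided bound for the complement gives the reverse
    -- inequality.
    · have h := key Eᶜ
      rw [q.toReal_toOuterMeasure_compl, p.toReal_toOuterMeasure_compl] at h
      linarith
  linarith

/-! ### The exact law of small remainders -/

namespace WeightedSpecies

theorem card_fst_remainder (F G : WeightedSpecies) {n : ℕ} (S : (F.comp G).obj (Fin n))
    (Q : S.1.1) : Nat.card Q.1 + (F.remainder G S Q).1 = n := by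
  change Nat.card Q.1 + Nat.card ↥(Q.1ᶜ) = n
  have := Set.ncard_add_ncard_compl Q.1
  rwa [Nat.card_fin] at this

theorem SetPartition.card_add_card_le {n : ℕ} (π : SetPartition (Fin n)) {Q Q' : π.1}
    (h : Q ≠ Q') : Nat.card Q.1 + Nat.card Q'.1 ≤ n := by
  have hd : Disjoint Q.1 Q'.1 := Set.disjoint_left.2 fun u hu hu' =>
    h (Subtype.ext (π.eq_of_mem Q.2 Q'.2 hu hu'))
  have h1 := Set.ncard_union_eq hd
  have h2 := Set.ncard_le_card (Q.1 ∪ Q'.1)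
  rw [Nat.card_fin, h1] at h2
  exact h2

open Classical in
/-- A component with more than half of the labels is the one deleted by the remainder. -/
theorem map_remainder_apply (F G : WeightedSpecies) {n : ℕ} (S : (F.comp G).obj (Fin n))
    (hS : S.1.largest.Nonempty) (R : (F.deriv.comp G).Universe) (hR : 2 * R.1 < n) :
    (PMF.uniformOfFinset S.1.largest hS).map (F.remainder G S) R
      = ∑' Q : S.1.1, if F.remainder G S Q = R then 1 else 0 := by
  by_cases h : ∃ Q, F.remainder G S Q = R
  · obtain ⟨Q, hQ⟩ := h
    have hcard : ∀ Q', F.remainder G S Q' = R → n < 2 * Nat.card Q'.1 := fun Q' hQ' => by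
      have := F.card_fst_remainder G S Q'
      rw [hQ'] at this
      omega
    have huniq : ∀ Q', Q' ≠ Q → Nat.card Q'.1 < Nat.card Q.1 := fun Q' hne => by
      have h1 := hcard Q hQ
      have h2 := S.1.card_add_card_le hne
      omega
    have hlargest : ∀ Q' ∈ S.1.largest, Q' = Q := fun Q' hQ' => by
      by_contra hne
      have h1 : ∀ Q'' : S.1.1, Nat.card Q''.1 ≤ Nat.card Q'.1 := by
        simpa [SetPartition.largest] using hQ'
      exact absurd (huniq Q' hne) (not_lt.2 (h1 Q))
    have hmem : Q ∈ S.1.largest := by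
      obtain ⟨Q', hQ'⟩ := hS
      exact hlargest Q' hQ' ▸ hQ'
    have hsing : S.1.largest = {Q} := Finset.eq_singleton_iff_unique_mem.2 ⟨hmem, hlargest⟩
    rw [PMF.map_apply, tsum_eq_single Q, tsum_eq_single Q, if_pos hQ, if_pos hQ.symm,
      PMF.uniformOfFinset_apply_of_mem _ hmem, hsing]
    · simp
    · intro Q' hne
      -- Two classes with remainder R would both hold more than half of the labels.
      refine if_neg fun hQ' => ?_
      have h1 := hcard Q' hQ'
      have h2 := huniq Q' hne
      have h3 := S.1.card_add_card_le hne
      omega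
    · intro Q' hne
      rw [PMF.uniformOfFinset_apply_of_notMem _ fun hQ' => hne (hlargest Q' hQ'), ite_self]
  · have h1 : ∀ Q, F.remainder G S Q ≠ R := fun Q hQ => h ⟨Q, hQ⟩
    rw [PMF.map_apply]
    simp only [h1, (h1 _).symm, if_false, tsum_zero]

/-- For a small R, the random choice among largest classes can be replaced by a sum over all
classes, which `tsum_remainder` evaluates; only the term r = |R| survives. -/
theorem remainderLaw_apply (F G : WeightedSpecies) [IsEmpty (G.obj (Fin 0))] {n : ℕ} (hn : 0 < n)
    (h : 0 < PowerSeries.coeff n (F.comp G).egf) (R : (F.deriv.comp G).Universe)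
    (hR : 2 * R.1 < n) :
    F.remainderLaw G n hn h R
      = (n.choose R.1 : ℝ≥0∞) * (G.mass (n - R.1) * (F.deriv.comp G).weight R.2)
        * ((F.comp G).mass n : ℝ≥0∞)⁻¹ := by
  classical
  have hne : Nonempty (Fin n) := ⟨⟨0, hn⟩⟩
  have h1 := F.tsum_remainder G n fun R' => if R' = R then 1 else 0
  rw [remainderLaw, PMF.bind_apply]
  simp only [sample, PMF.normalize_apply]
  rw [← coe_mass]
  have h2 : ∀ S : (F.comp G).obj (Fin n),
      ((F.comp G).weight S : ℝ≥0∞) * ((F.comp G).mass n : ℝ≥0∞)⁻¹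
        * (PMF.uniformOfFinset S.1.largest S.1.largest_nonempty).map (F.remainder G S) R
      = (∑' Q : S.1.1, ((F.comp G).weight S : ℝ≥0∞) * if F.remainder G S Q = R then 1 else 0)
        * ((F.comp G).mass n : ℝ≥0∞)⁻¹ := fun S => by
    rw [F.map_remainder_apply G S _ R hR, ENNReal.tsum_mul_left]
    ring
  rw [tsum_congr h2, ENNReal.tsum_mul_right, h1]
  congr 1
  obtain ⟨r, R⟩ := R
  dsimp only at hR ⊢
  rw [Finset.sum_eq_single r]
  · congr 2
    rw [tsum_eq_single R]
    · simp
    · intro R' hR'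
      rw [if_neg (fun h => hR' (by simpa using h)), mul_zero]
  · intro r' _ hr'
    have : ∀ R', (⟨r', R'⟩ : (F.deriv.comp G).Universe) ≠ ⟨r, R⟩ :=
      fun R' h => hr' (congrArg Sigma.fst h)
    simp [this]
  · intro hr
    exact absurd (Finset.mem_range.2 (by omega)) hr

theorem coe_mass_eq (F : WeightedSpecies) (n : ℕ) :
    (F.mass n : ℝ) = n.factorial * PowerSeries.coeff n F.egf := by
  have : (n.factorial : ℝ) ≠ 0 := Nat.cast_ne_zero.2 (Nat.factorial_ne_zero _)
  rw [coeff_egf]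
  field_simp

theorem toReal_remainderLaw_apply (F G : WeightedSpecies) [IsEmpty (G.obj (Fin 0))] {n : ℕ}
    (hn : 0 < n) (h : 0 < PowerSeries.coeff n (F.comp G).egf) (R : (F.deriv.comp G).Universe)
    (hR : 2 * R.1 < n) :
    (F.remainderLaw G n hn h R).toReal
      = (F.deriv.comp G).weight R.2 / R.1.factorial * (PowerSeries.coeff (n - R.1) G.egf
        / PowerSeries.coeff n (F.comp G).egf) := by
  rw [F.remainderLaw_apply G hn h R hR]
  simp only [ENNReal.toReal_mul, ENNReal.toReal_inv, ENNReal.toReal_natCast,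
    ENNReal.coe_toReal]
  have hr : R.1 ≤ n := by omega
  have h1 : (R.1.factorial : ℝ) ≠ 0 := Nat.cast_ne_zero.2 (Nat.factorial_ne_zero _)
  have h2 : ((n - R.1).factorial : ℝ) ≠ 0 := Nat.cast_ne_zero.2 (Nat.factorial_ne_zero _)
  have h3 : (n.choose R.1 : ℝ) ≠ 0 := Nat.cast_ne_zero.2 (Nat.choose_pos hr).ne'
  rw [coe_mass_eq, coe_mass_eq, ← Nat.choose_mul_factorial_mul_factorial hr]
  push_cast
  field_simp

/-! ### Generating series of composite species -/

/-- The value of the generating series, as a sum over the sizes. -/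
theorem value_eq_tsum (F : WeightedSpecies) (y : ℝ≥0) :
    F.value y = ∑' n, ENNReal.ofNNReal (PowerSeries.coeff n (PowerSeries.rescale y F.egfNN)) := by
  rw [value, ENNReal.tsum_sigma']
  refine tsum_congr fun n => ?_
  rw [PowerSeries.coeff_rescale, coeff_egfNN,
    show y ^ n * (F.mass n / n.factorial) = F.mass n * (y ^ n / n.factorial) by ring,
    ENNReal.coe_mul, coe_mass, ← ENNReal.tsum_mul_right]
  refine tsum_congr fun x => ?_
  rw [boltzmannWeight, mul_div_assoc, ENNReal.coe_mul]

/-- The coefficients of the series of a composite species. -/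
theorem coeff_egfNN_comp (F G : WeightedSpecies) [IsEmpty (G.obj (Fin 0))] (n : ℕ) :
    ENNReal.ofNNReal (PowerSeries.coeff n (F.comp G).egfNN)
      = ∑' k, ((PowerSeries.coeff k F.egfNN * PowerSeries.coeff n (G.egfNN ^ k) : ℝ≥0) : ℝ≥0∞) := by
  have hn : (n.factorial : ℝ≥0) ≠ 0 := Nat.cast_ne_zero.2 (Nat.factorial_ne_zero _)
  rw [coeff_egfNN, div_eq_mul_inv, ENNReal.coe_mul, ← tsum_compMass,
    ← ENNReal.tsum_mul_right]
  refine tsum_congr fun k => ?_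
  have hk : (k.factorial : ℝ≥0) ≠ 0 := Nat.cast_ne_zero.2 (Nat.factorial_ne_zero _)
  have h := congrArg (fun x => (((k.factorial : ℝ≥0)⁻¹ : ℝ≥0) : ℝ≥0∞) * x)
    (F.factorial_mul_compMass G k n)
  rw [← mul_assoc, ← ENNReal.coe_natCast, ← ENNReal.coe_mul, inv_mul_cancel₀ hk, ENNReal.coe_one,
    one_mul] at h
  rw [h, ← ENNReal.coe_mul, ← ENNReal.coe_mul]
  congr 1
  rw [F.coeff_egfNN]
  field_simp

theorem hasSum_coeff_egf_comp (F G : WeightedSpecies) [IsEmpty (G.obj (Fin 0))] (n : ℕ) :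
    HasSum (fun k => PowerSeries.coeff k F.egf * PowerSeries.coeff n (G.egf ^ k))
      (PowerSeries.coeff n (F.comp G).egf) := by
  have h := F.coeff_egfNN_comp G n
  have h1 : HasSum (fun k => PowerSeries.coeff k F.egfNN * PowerSeries.coeff n (G.egfNN ^ k))
      (PowerSeries.coeff n (F.comp G).egfNN) := by
    rw [← ENNReal.hasSum_coe, h]
    exact ENNReal.summable.hasSum
  have h2 := NNReal.hasSum_coe.2 h1
  simp only [← map_egfNN, ← map_pow, PowerSeries.coeff_map]
  simpa using h2

/-- The mass of the structures with k classes is a multiple of this coefficient. It serves to locate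
the sizes of remainders of positive weight on a lattice. -/
theorem coeff_egf_pow_ne_zero_of_weight_ne_zero (F G : WeightedSpecies) [IsEmpty (G.obj (Fin 0))] {n : ℕ}
    (S : (F.comp G).obj (Fin n)) (hS : (F.comp G).weight S ≠ 0) :
    PowerSeries.coeff n (G.egf ^ Nat.card S.1.1) ≠ 0 := by
  classical
  intro h0
  have h1 : PowerSeries.coeff n (G.egfNN ^ Nat.card S.1.1) = 0 := by
    rw [← map_egfNN, ← map_pow, PowerSeries.coeff_map] at h0
    exact NNReal.coe_eq_zero.1 h0
  have h2 := F.factorial_mul_compMass G (Nat.card S.1.1) n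
  rw [h1, mul_zero, mul_zero, ENNReal.coe_zero, mul_eq_zero] at h2
  rcases h2 with h2 | h2
  · exact Nat.factorial_ne_zero _ (by exact_mod_cast h2)
  · have h3 := ENNReal.tsum_eq_zero.1 h2 S
    rw [if_pos rfl] at h3
    exact hS (by exact_mod_cast h3)

theorem tsum_coeff_mul (u v : PowerSeries ℝ≥0) :
    ∑' n, ENNReal.ofNNReal (PowerSeries.coeff n (u * v))
      = (∑' n, ENNReal.ofNNReal (PowerSeries.coeff n u)) * ∑' n, ENNReal.ofNNReal (PowerSeries.coeff n v) := by
  calc _ = ∑' n, ∑' x : Finset.HasAntidiagonal.antidiagonal n,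
        ENNReal.ofNNReal (PowerSeries.coeff x.1.1 u) * ENNReal.ofNNReal (PowerSeries.coeff x.1.2 v) := by
        refine tsum_congr fun n => ?_
        rw [PowerSeries.coeff_mul, ENNReal.ofNNReal_finsetSum,
          Finset.tsum_subtype _ fun x : ℕ × ℕ =>
            ENNReal.ofNNReal (PowerSeries.coeff x.1 u) * ENNReal.ofNNReal (PowerSeries.coeff x.2 v)]
        exact Finset.sum_congr rfl fun x _ => ENNReal.coe_mul _ _
    _ = ∑' x : ℕ × ℕ, ENNReal.ofNNReal (PowerSeries.coeff x.1 u) * ENNReal.ofNNReal (PowerSeries.coeff x.2 v) := by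
        rw [← Finset.HasAntidiagonal.sigmaAntidiagonalEquivProd.tsum_eq, ENNReal.tsum_sigma']
        rfl
    _ = _ := by
        rw [ENNReal.tsum_prod', ← ENNReal.tsum_mul_right]
        refine tsum_congr fun i => ?_
        dsimp only
        rw [ENNReal.tsum_mul_left]

theorem tsum_coeff_pow (u : PowerSeries ℝ≥0) (k : ℕ) :
    ∑' n, ENNReal.ofNNReal (PowerSeries.coeff n (u ^ k)) = (∑' n, ENNReal.ofNNReal (PowerSeries.coeff n u)) ^ k := by
  induction k with
  | zero =>
    rw [tsum_eq_single 0 fun n hn => by rw [pow_zero, PowerSeries.coeff_one, if_neg hn,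
      ENNReal.coe_zero]]
    simp
  | succ k ih => rw [pow_succ, pow_succ, tsum_coeff_mul, ih]

/-- The value of the series of a composite species. -/
theorem value_comp (F G : WeightedSpecies) [IsEmpty (G.obj (Fin 0))] (y : ℝ≥0) :
    (F.comp G).value y = ∑' k, ENNReal.ofNNReal (PowerSeries.coeff k F.egfNN) * G.value y ^ k := by
  rw [value_eq_tsum, value_eq_tsum]
  simp only [PowerSeries.coeff_rescale (F.comp G).egfNN, ENNReal.coe_mul, coeff_egfNN_comp,
    ← ENNReal.tsum_mul_left]
  rw [ENNReal.tsum_comm]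
  refine tsum_congr fun k => ?_
  rw [← tsum_coeff_pow, ← map_pow, ← ENNReal.tsum_mul_left]
  refine tsum_congr fun n => ?_
  rw [PowerSeries.coeff_rescale, ENNReal.coe_mul]
  ring

end WeightedSpecies

/-! ### Reduction to span 1, summability and the lattice of sizes -/

open Filter PowerSeries in
/-- A series `z^m g(z)` with `g ∈ 𝒮_d`, rescaled to radius of convergence `1`, is a subexponential
density on the lattice `m + dℕ`. -/
theorem IsSubexponential.exists_density {d m : ℕ} {ρ : ℝ≥0} {g : PowerSeries ℝ}
    (hg : IsSubexponential d ρ g) :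
    ∃ (p : PowerSeries ℝ) (P : ℝ), IsSubexponentialDensity p P ∧
      HasSum (fun n => coeff n (rescale (ρ : ℝ) (X ^ m * g))) P ∧
      ∀ k n, coeff n (rescale (ρ : ℝ) (X ^ m * g) ^ k)
        = if m * k ≤ n then (if d ∣ n - m * k then coeff ((n - m * k) / d) (p ^ k) else 0)
          else 0 := by
  have hd : d ≠ 0 := by have := hg.one_le; omega
  have hρ : (0 : ℝ) < ρ := hg.radius_pos
  set q : PowerSeries ℝ := PowerSeries.mk fun n => coeff (d * n) g with hq
  -- Rescaling z^m g by ρ produces ρ^m from z^m and ρ^d from each step of the lattice, so the result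
  -- is z^m p(z^d).
  set p : PowerSeries ℝ := C ((ρ : ℝ) ^ m) * rescale ((ρ : ℝ) ^ d) q with hpdef
  have hpc : ∀ n, coeff n p = (ρ : ℝ) ^ m * (((ρ : ℝ) ^ d) ^ n * coeff (d * n) g) := fun n => by
    rw [hpdef, coeff_C_mul, coeff_rescale, hq, coeff_mk]
  have hgq : g = expand d hd q := by
    ext n
    rw [coeff_expand]
    split_ifs with h
    · rw [hq, coeff_mk, Nat.mul_div_cancel' h]
    · exact hg.support n h
  have hinj : Function.Injective fun n : ℕ => d * n := mul_right_injective₀ hd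
  set T := ∑' n, coeff n g * (ρ : ℝ) ^ n with hT
  have hsum : HasSum (fun n => coeff n p) (ρ ^ m * T) := by
    have h1 : HasSum (fun n => coeff (d * n) g * (ρ : ℝ) ^ (d * n)) T := by
      refine (hinj.hasSum_iff (f := fun n => coeff n g * (ρ : ℝ) ^ n) fun n hn => ?_).2
        hg.summable.hasSum
      rw [hg.support n fun ⟨k, hk⟩ => hn ⟨k, hk.symm⟩, zero_mul]
    refine (h1.mul_left _).congr_fun fun n => ?_
    rw [hpc, pow_mul, mul_comm (coeff _ g)]
  have hnonneg : ∀ n, 0 ≤ coeff n p := fun n => by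
    rw [hpc]
    have := hg.nonneg (d * n)
    positivity
  have hfac : rescale (ρ : ℝ) (X ^ m * g) = X ^ m * expand d hd p := by
    ext n
    rw [coeff_rescale, coeff_X_pow_mul', coeff_X_pow_mul']
    split_ifs with h
    · rw [coeff_expand]
      split_ifs with h'
      · rw [hpc, Nat.mul_div_cancel' h', ← pow_mul, Nat.mul_div_cancel' h', ← mul_assoc, ← pow_add,
          Nat.add_sub_cancel' h]
      · rw [hg.support _ h', mul_zero]
    · rw [mul_zero]
  have hexp : HasSum (fun n => coeff n (expand d hd p)) (ρ ^ m * T) := by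
    refine (hinj.hasSum_iff (f := fun n => coeff n (expand d hd p)) fun n hn => ?_).1 ?_
    · rw [coeff_expand, if_neg fun ⟨k, hk⟩ => hn ⟨k, hk.symm⟩]
    · refine hsum.congr_fun fun n => ?_
      rw [Function.comp, coeff_expand, if_pos (dvd_mul_right d n),
        Nat.mul_div_cancel_left n (Nat.pos_of_ne_zero hd)]
  refine ⟨p, ρ ^ m * T, ⟨hnonneg, hsum, ?_, ?_⟩, ?_, fun k n => ?_⟩
  · have h := hg.ratio.div_const ((ρ : ℝ) ^ d)
    rw [div_self (by positivity)] at h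
    refine h.congr fun n => ?_
    rw [hpc, hpc, mul_div_mul_left _ _ (by positivity), pow_succ, mul_assoc,
      mul_div_mul_left _ _ (by positivity), mul_add, mul_one, div_div, mul_comm ((ρ : ℝ) ^ d)]
  · have h := hg.convolution.const_mul ((ρ : ℝ) ^ m)
    rw [show (ρ : ℝ) ^ m * (2 * T) = 2 * (ρ ^ m * T) by ring] at h
    refine h.congr fun n => ?_
    have h1 : coeff n (p * p) = (ρ : ℝ) ^ m * (ρ ^ m * ((ρ ^ d) ^ n * coeff (d * n) (g * g))) := by
      rw [hpdef, show C ((ρ : ℝ) ^ m) * rescale ((ρ : ℝ) ^ d) q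
        * (C ((ρ : ℝ) ^ m) * rescale ((ρ : ℝ) ^ d) q)
        = C ((ρ : ℝ) ^ m) * (C ((ρ : ℝ) ^ m) * rescale ((ρ : ℝ) ^ d) (q * q)) by
          rw [map_mul]; ring, coeff_C_mul, coeff_C_mul, coeff_rescale, hgq, ← map_mul,
        coeff_expand, if_pos (dvd_mul_right d n),
        Nat.mul_div_cancel_left n (Nat.pos_of_ne_zero hd)]
    rw [← coeff_mul, h1, hpc, mul_div_assoc ((ρ : ℝ) ^ m), mul_div_mul_left _ _ (by positivity),
      mul_div_mul_left _ _ (by positivity)]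
  · rw [hfac]
    have hX : HasSum (fun n => coeff n (X ^ m : PowerSeries ℝ)) 1 := by
      simp only [coeff_X_pow]
      exact hasSum_ite_eq m 1
    have h := hasSum_coeff_mul (fun n => by rw [coeff_X_pow]; split_ifs <;> norm_num)
      (fun n => by rw [coeff_expand]; split_ifs; exacts [hnonneg _, le_rfl]) hX hexp
    rwa [one_mul] at h
  · rw [hfac, mul_pow, ← pow_mul, ← map_pow, coeff_X_pow_mul', coeff_expand]

/-- Convexity of the k-th power: the tangent at y lies below the graph at x. This bounds k y^(k-1)
by x^k / (x - y). -/
theorem mul_pow_pred_add_pow_le {x y : ℝ} (hy : 0 ≤ y) (hxy : y ≤ x) (k : ℕ) :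
    (x - y) * (k * y ^ (k - 1)) + y ^ k ≤ x ^ k := by
  induction k with
  | zero => simp
  | succ k ih =>
    have h1 := mul_le_mul_of_nonneg_left ih (hy.trans hxy)
    have h2 : (k : ℝ) * y ^ k = k * y ^ (k - 1) * y := by
      cases k with
      | zero => simp
      | succ j => rw [Nat.add_sub_cancel, pow_succ]; ring
    have h3 : (k : ℝ) * y ^ (k - 1) * y ≤ k * y ^ (k - 1) * x :=
      mul_le_mul_of_nonneg_left hxy (by positivity)
    rw [Nat.add_sub_cancel]
    push_cast
    calc (x - y) * ((k + 1) * y ^ k) + y ^ (k + 1)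
        = (x - y) * (k * y ^ k) + x * y ^ k := by ring
      _ ≤ (x - y) * (k * y ^ (k - 1) * x) + x * y ^ k := by
          rw [h2]
          exact add_le_add_left (mul_le_mul_of_nonneg_left h3 (by linarith)) _
      _ = x * ((x - y) * (k * y ^ (k - 1)) + y ^ k) := by ring
      _ ≤ x * x ^ k := h1
      _ = x ^ (k + 1) := by ring

theorem summable_mul_pow_pred {c : ℕ → ℝ} (hc : ∀ k, 0 ≤ c k) {x y : ℝ} (hy : 0 ≤ y) (hxy : y < x)
    (h : Summable fun k => c k * x ^ k) : Summable fun k => c k * (k * y ^ (k - 1)) := by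
  refine Summable.of_nonneg_of_le (fun k => mul_nonneg (hc k) (by positivity)) (fun k => ?_)
    (h.mul_left (x - y)⁻¹)
  have h1 := mul_pow_pred_add_pow_le hy hxy.le k
  have h2 : (k : ℝ) * y ^ (k - 1) ≤ (x - y)⁻¹ * x ^ k := by
    rw [inv_mul_eq_div, le_div_iff₀ (by linarith), mul_comm]
    linarith [pow_nonneg hy k]
  calc c k * (k * y ^ (k - 1)) ≤ c k * ((x - y)⁻¹ * x ^ k) :=
        mul_le_mul_of_nonneg_left h2 (hc k)
    _ = (x - y)⁻¹ * (c k * x ^ k) := by ring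

theorem exists_summable_of_lt_radiusOfConvergence {f : PowerSeries ℝ} {y : ℝ≥0}
    (h : (y : ℝ≥0∞) < radiusOfConvergence f) :
    ∃ x : ℝ, y < x ∧ Summable fun k => |PowerSeries.coeff k f| * x ^ k := by
  obtain ⟨r, hyr, hr⟩ := ENNReal.lt_iff_exists_nnreal_btwn.1 h
  refine ⟨r, by exact_mod_cast hyr, ?_⟩
  have h1 := FormalMultilinearSeries.summable_norm_mul_pow _ hr
  simpa [FormalMultilinearSeries.ofScalars_norm] using h1

namespace WeightedSpecies

theorem coeff_egf_nonneg (F : WeightedSpecies) (n : ℕ) : 0 ≤ PowerSeries.coeff n F.egf := by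
  rw [coeff_egf]
  positivity

theorem coe_coeff_egfNN (F : WeightedSpecies) (n : ℕ) :
    ((PowerSeries.coeff n F.egfNN : ℝ≥0) : ℝ) = PowerSeries.coeff n F.egf := by
  rw [← map_egfNN, PowerSeries.coeff_map]
  rfl

theorem coeff_egf_restrict (F : WeightedSpecies) (D a k : ℕ) :
    PowerSeries.coeff k (F.restrict D a).egf
      = if k ≡ a [MOD D] then PowerSeries.coeff k F.egf else 0 := by
  rw [coeff_egf, coeff_egf]
  split_ifs with h
  · congr 2
    exact (Equiv.subtypeUnivEquiv fun _ : F.obj (Fin k) =>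
      (show Nat.card (Fin k) ≡ a [MOD D] by rwa [Nat.card_fin])).tsum_eq F.weight
  · have : IsEmpty ((F.restrict D a).obj (Fin k)) :=
      ⟨fun x => h (by simpa only [Nat.card_fin] using x.2)⟩
    simp [mass]

theorem coeff_egf_deriv (F : WeightedSpecies) (k : ℕ) :
    PowerSeries.coeff k F.deriv.egf = (k + 1) * PowerSeries.coeff (k + 1) F.egf := by
  rw [coeff_egf, coeff_egf, mass_deriv, Nat.factorial_succ]
  have : (k.factorial : ℝ) ≠ 0 := Nat.cast_ne_zero.2 (Nat.factorial_ne_zero _)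
  push_cast
  field_simp

theorem value_eq_of_hasSum (G : WeightedSpecies) {ρ P : ℝ≥0}
    (h : HasSum (fun n => PowerSeries.coeff n (PowerSeries.rescale (ρ : ℝ) G.egf)) P) :
    G.value ρ = P := by
  rw [value_eq_tsum]
  refine HasSum.tsum_eq (ENNReal.hasSum_coe.2 (NNReal.hasSum_coe.1 (h.congr_fun fun n => ?_)))
  rw [PowerSeries.coeff_rescale, PowerSeries.coeff_rescale, NNReal.coe_mul, coe_coeff_egfNN,
    NNReal.coe_pow]

/-- The value is F'(P); the index shift of the derivative loses nothing because the term k = 0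
vanishes. -/
theorem value_deriv_comp (F G : WeightedSpecies) [IsEmpty (G.obj (Fin 0))] {ρ P V : ℝ≥0}
    (hP : G.value ρ = P)
    (h : HasSum (fun k : ℕ => PowerSeries.coeff k F.egf * (k * (P : ℝ) ^ (k - 1))) V) :
    (F.deriv.comp G).value ρ = V := by
  rw [value_comp, hP]
  have h1 := (hasSum_nat_add_iff' 1).2 h
  simp only [Finset.range_one, Finset.sum_singleton, Nat.cast_zero, zero_mul, mul_zero,
    sub_zero, Nat.add_sub_cancel] at h1
  simp only [← ENNReal.coe_pow, ← ENNReal.coe_mul]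
  refine HasSum.tsum_eq (ENNReal.hasSum_coe.2 (NNReal.hasSum_coe.1 (h1.congr_fun fun k => ?_)))
  rw [NNReal.coe_mul, coe_coeff_egfNN, coeff_egf_deriv, NNReal.coe_pow]
  push_cast
  ring

theorem inclusion_injective (F G : WeightedSpecies) (D a : ℕ) :
    Function.Injective (F.inclusion G D a) := by
  rintro ⟨r, π, ⟨x, hx⟩, y⟩ ⟨r', π', ⟨x', hx'⟩, y'⟩ h
  simp only [inclusion] at h
  cases h
  rfl

end WeightedSpecies

/-- A multiple of `m` in the residue class of `am` modulo `d`. -/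
theorem Nat.mul_eq_of_modEq_div_gcd {d m D a k : ℕ} (hD : D = d / Nat.gcd m d) (ha : a < D)
    (hk : k ≡ a [MOD D]) : m * k = a * m + d * (m / Nat.gcd m d * (k / D)) := by
  have h := Nat.mod_add_div k D
  rw [Nat.mod_eq_of_modEq hk ha] at h
  have hmD : m * D = d * (m / Nat.gcd m d) := by
    rw [hD, ← Nat.mul_div_assoc _ (Nat.gcd_dvd_right m d),
      ← Nat.mul_div_assoc _ (Nat.gcd_dvd_left m d), mul_comm]
  calc m * k = m * (a + D * (k / D)) := by rw [h]
    _ = a * m + m * D * (k / D) := by ring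
    _ = _ := by rw [hmD]; ring

namespace WeightedSpecies

theorem boltzmann_apply (F : WeightedSpecies) (y : ℝ≥0) (h0 : F.value y ≠ 0) (h : F.value y ≠ ∞)
    (x : F.Universe) : F.boltzmann y h0 h x = F.boltzmannWeight y x * (F.value y)⁻¹ :=
  PMF.normalize_apply _ _ _

open Filter PowerSeries

/-- The contribution of the structures with `k` components to the coefficient of the composite
series of index `am + dt`. -/
theorem coeff_mul_coeff_pow_lattice (F : WeightedSpecies) {Γ p : PowerSeries ℝ} {d m D a : ℕ}
    (hd : 0 < d) (hD : D = d / Nat.gcd m d) (ha : a < D)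
    (hΓ : ∀ k n, coeff n (Γ ^ k)
      = if m * k ≤ n then (if d ∣ n - m * k then coeff ((n - m * k) / d) (p ^ k) else 0) else 0)
    (k t : ℕ) :
    coeff k F.egf * coeff (a * m + d * t) (Γ ^ k)
      = coeff k (F.restrict D a).egf * (if m / Nat.gcd m d * (k / D) ≤ t
          then coeff (t - m / Nat.gcd m d * (k / D)) (p ^ k) else 0) := by
  rw [coeff_egf_restrict]
  by_cases hk : k ≡ a [MOD D]
  · rw [if_pos hk]
    congr 1
    have hmk := Nat.mul_eq_of_modEq_div_gcd (m := m) hD ha hk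
    set j := k / D
    set μ := m / Nat.gcd m d
    rw [hΓ, hmk, Nat.add_sub_add_left, ← Nat.mul_sub]
    by_cases hjt : μ * j ≤ t
    · rw [if_pos (by gcongr), if_pos (dvd_mul_right _ _), if_pos hjt,
        Nat.mul_div_cancel_left _ hd]
    · rw [if_neg hjt, if_neg]
      intro h
      exact hjt (Nat.le_of_mul_le_mul_left (Nat.le_of_add_le_add_left h) hd)
  · rw [if_neg hk, zero_mul, hΓ]
    split_ifs with h1 h2
    · refine absurd ?_ hk
      have h3 : m * k ≡ m * a [MOD d] := by
        have h4 : m * k ≡ a * m + d * t [MOD d] := (Nat.modEq_iff_dvd' h1).2 h2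
        refine h4.trans ?_
        rw [mul_comm a m]
        exact Nat.modEq_iff_dvd.2 ⟨-t, by push_cast; ring⟩
      rw [hD, Nat.gcd_comm]
      -- Cancelling m modulo d leaves a congruence modulo d / gcd(m, d) = D.
      exact Nat.ModEq.cancel_left_div_gcd hd h3
    · rw [mul_zero]
    · rw [mul_zero]

end WeightedSpecies

end

/-! ### Convergence of the remainder -/

open WeightedSpecies Filter in
theorem theorem3p4 (F G : WeightedSpecies) (hG : IsEmpty (G.obj (Fin 0)))
    (d m : ℕ) (hm : m < d) (ρ : NNReal) (g : PowerSeries ℝ)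
    (hg : IsSubexponential d ρ g) (hGg : G.egf = PowerSeries.X ^ m * g)
    (hF : G.value ρ < radiusOfConvergence F.egf)
    (D : ℕ) (hD : D = d / Nat.gcd m d) (a : ℕ) (ha : a < D)
    (hFa : ¬ ∃ c : ℝ, (F.restrict D a).egf = PowerSeries.C c) :
    ∃ (h0 : ((F.restrict D a).deriv.comp G).value ρ ≠ 0)
      (h1 : ((F.restrict D a).deriv.comp G).value ρ ≠ ⊤),
      ∀ ε : ℝ, 0 < ε → ∃ N : ℕ, ∀ n : ℕ, N ≤ n → n ≡ a * m [MOD d] →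
        ∃ (hn : 0 < n) (hpos : 0 < PowerSeries.coeff n (F.comp G).egf),
          dTV (F.remainderLaw G n hn hpos)
            ((((F.restrict D a).deriv.comp G).boltzmann ρ h0 h1).map (F.inclusion G D a)) < ε := by
  have hd : 0 < d := by omega
  have hρ : (0 : ℝ) < ρ := hg.radius_pos
  obtain ⟨p, P, hp, hsumΓ, hΓ⟩ := hg.exists_density (m := m)
  rw [← hGg] at hsumΓ hΓ
  have hP := hp.sum_pos
  lift P to ℝ≥0 using hP.le
  have hGP : G.value ρ = P := G.value_eq_of_hasSum hsumΓ
  rw [hGP] at hF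
  obtain ⟨x, hPx, hx⟩ := exists_summable_of_lt_radiusOfConvergence hF
  set c : ℕ → ℝ := fun k => PowerSeries.coeff k (F.restrict D a).egf with hcdef
  have hc0 : ∀ k, 0 ≤ c k := fun k => coeff_egf_nonneg _ k
  have hx0 : 0 < x := hP.trans hPx
  have hcx : Summable fun k => c k * x ^ k := by
    refine Summable.of_nonneg_of_le (fun k => mul_nonneg (hc0 k) (by positivity)) (fun k => ?_) hx
    refine mul_le_mul_of_nonneg_right ?_ (by positivity)
    simp only [hcdef, coeff_egf_restrict]
    split_ifs
    exacts [le_abs_self _, abs_nonneg _]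
  have hsV := summable_mul_pow_pred hc0 P.2 hPx hcx
  have hnn : ∀ k : ℕ, 0 ≤ c k * (k * (P : ℝ) ^ (k - 1)) :=
    fun k => mul_nonneg (hc0 k) (by positivity)
  obtain ⟨V, hV⟩ : ∃ V : ℝ≥0, HasSum (fun k : ℕ => c k * (k * (P : ℝ) ^ (k - 1))) V :=
    ⟨⟨_, tsum_nonneg hnn⟩, hsV.hasSum⟩
  have hVpos : (0 : ℝ) < V := by
    -- A non-constant series has a non-zero coefficient of positive index, which the derivative does
    -- not kill.
    obtain ⟨k, hk⟩ : ∃ k, c (k + 1) ≠ 0 := by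
      by_contra! h
      refine hFa ⟨c 0, PowerSeries.ext fun n => ?_⟩
      rw [PowerSeries.coeff_C]
      cases n with
      | zero => rfl
      | succ n => exact h n
    have hck : 0 < c (k + 1) := lt_of_le_of_ne (hc0 _) hk.symm
    refine lt_of_lt_of_le ?_ (le_hasSum hV (k + 1) fun i _ => hnn i)
    positivity
  have hval : ((F.restrict D a).deriv.comp G).value ρ = V :=
    (F.restrict D a).value_deriv_comp G hGP hV
  have h0 : ((F.restrict D a).deriv.comp G).value ρ ≠ 0 := by
    rw [hval]
    exact_mod_cast hVpos.ne'
  have h1 : ((F.restrict D a).deriv.comp G).value ρ ≠ ⊤ := by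
    rw [hval]
    exact ENNReal.coe_ne_top
  refine ⟨h0, h1, fun ε hε => ?_⟩
  have hcoeff : ∀ t, PowerSeries.coeff (a * m + d * t) (F.comp G).egf * ρ ^ (a * m + d * t)
      = ∑' k, c k * (if m / Nat.gcd m d * (k / D) ≤ t
          then PowerSeries.coeff (t - m / Nat.gcd m d * (k / D)) (p ^ k) else 0) := fun t => by
    rw [← ((F.hasSum_coeff_egf_comp G (a * m + d * t)).mul_right _).tsum_eq]
    refine tsum_congr fun k => ?_
    rw [← F.coeff_mul_coeff_pow_lattice hd hD ha hΓ k t, ← map_pow, PowerSeries.coeff_rescale]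
    ring
  have hlim : Tendsto (fun t => PowerSeries.coeff (a * m + d * t) (F.comp G).egf
      * ρ ^ (a * m + d * t) / PowerSeries.coeff t p) atTop (𝓝 V) := by
    have h := hp.tendsto_tsum_pow hc0 (k := fun k => k) (s := fun k => m / Nat.gcd m d * (k / D))
      (μ := m / Nat.gcd m d) (fun k => Nat.mul_le_mul_left _ (Nat.div_le_self k D)) hPx hcx
    rw [hV.tsum_eq] at h
    exact h.congr fun t => by rw [hcoeff]
  have hcpos : ∀ᶠ t in atTop, 0 < PowerSeries.coeff (a * m + d * t) (F.comp G).egf := by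
    filter_upwards [hlim.eventually (lt_mem_nhds hVpos)] with t ht
    refine lt_of_le_of_ne (coeff_egf_nonneg _ _) fun h => ?_
    rw [← h, zero_mul, zero_div] at ht
    exact lt_irrefl _ ht
  set q := (((F.restrict D a).deriv.comp G).boltzmann ρ h0 h1).map (F.inclusion G D a) with hq
  obtain ⟨s, hs, δ, hδ, hsδ⟩ := exists_finset_dTV_lt q hε
  have hpoint : ∀ R ∈ s, ∀ᶠ t in atTop, (q R).toReal - δ
      ≤ (F.deriv.comp G).weight R.2 / R.1.factorial
        * (PowerSeries.coeff (a * m + d * t - R.1) G.egf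
          / PowerSeries.coeff (a * m + d * t) (F.comp G).egf) := by
    intro R hR
    obtain ⟨R', -, rfl⟩ := (PMF.mem_support_map_iff _ _ _).1 ((PMF.mem_support_iff _ _).2 (hs R hR))
    have hqR : (q (F.inclusion G D a R')).toReal
        = ((F.restrict D a).deriv.comp G).weight R'.2 / R'.1.factorial * (ρ ^ R'.1 / V) := by
      rw [hq, PMF.map_apply, tsum_eq_single R', if_pos rfl, boltzmann_apply,
        hval, boltzmannWeight, ENNReal.toReal_mul,
        ENNReal.toReal_inv, ENNReal.coe_toReal, ENNReal.coe_toReal]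
      · push_cast
        ring
      · exact fun R'' hne => if_neg fun h => hne (F.inclusion_injective G D a h).symm
    have hw : ((F.restrict D a).deriv.comp G).weight R'.2 ≠ 0 := by
      intro h
      apply hs _ hR
      rw [h, NNReal.coe_zero, zero_div, zero_mul,
        ENNReal.toReal_eq_zero_iff] at hqR
      exact hqR.resolve_right (q.apply_ne_top _)
    have hr := ((F.restrict D a).deriv).coeff_egf_pow_ne_zero_of_weight_ne_zero G R'.2 hw
    have hRa : Nat.card R'.2.1.1 + 1 ≡ a [MOD D] := by
      have := R'.2.2.1.2
      rwa [Finite.card_option] at this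
    obtain ⟨r, R₂⟩ := R'
    dsimp only at hqR hw hr hRa
    set k := Nat.card R₂.1.1
    obtain ⟨u, hu⟩ : ∃ u, r = m * k + d * u := by
      have h := hΓ k r
      rw [← map_pow, PowerSeries.coeff_rescale] at h
      by_cases h2 : m * k ≤ r
      · by_cases h3 : d ∣ r - m * k
        · obtain ⟨u, hu⟩ := h3
          exact ⟨u, by omega⟩
        · rw [if_pos h2, if_neg h3] at h
          exact absurd h (mul_ne_zero (by positivity) hr)
      · rw [if_neg h2] at h
        exact absurd h (mul_ne_zero (by positivity) hr)
    -- With r = mk + du this puts the deleted component on the support of G: am + dt - r = m + d(t -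
    -- (u + j)). Its rescaled coefficient is therefore that of p at t - (u + j).
    obtain ⟨j, hj⟩ : ∃ j, m * k + m = a * m + d * j :=
      ⟨_, Nat.mul_eq_of_modEq_div_gcd hD ha hRa⟩
    have hcomp : Tendsto (fun t => PowerSeries.coeff (a * m + d * t - r) G.egf
        / PowerSeries.coeff (a * m + d * t) (F.comp G).egf) atTop (𝓝 (ρ ^ r / V)) := by
      have h2 := ((hp.tendsto_shift (u + j)).div hlim hVpos.ne').const_mul ((ρ : ℝ) ^ r)
      rw [mul_one_div] at h2
      refine h2.congr' ?_
      filter_upwards [hp.eventually_pos, hcpos, eventually_ge_atTop (u + j)] with t ht htc htu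
      have h3 : a * m + d * t - r = m * 1 + d * (t - (u + j)) := by
        obtain ⟨t', rfl⟩ := Nat.exists_eq_add_of_le htu
        rw [Nat.add_sub_cancel_left, mul_add, mul_add]
        omega
      have h4 := hΓ 1 (a * m + d * t - r)
      rw [pow_one, pow_one, h3, if_pos (Nat.le_add_right _ _), Nat.add_sub_cancel_left,
        if_pos (dvd_mul_right _ _), Nat.mul_div_cancel_left _ hd, ← h3,
        PowerSeries.coeff_rescale] at h4
      have h5 : a * m + d * t = r + (a * m + d * t - r) := by
        obtain ⟨t', rfl⟩ := Nat.exists_eq_add_of_le htu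
        rw [mul_add, mul_add]
        omega
      have h6 : (ρ : ℝ) ^ (a * m + d * t) = ρ ^ r * ρ ^ (a * m + d * t - r) := by
        rw [← pow_add, ← h5]
      rw [Pi.div_apply, ← h4, h6]
      have := hρ.ne'
      have := ht.ne'
      have := htc.ne'
      field_simp
    have h2 := hcomp.const_mul
      ((((F.restrict D a).deriv.comp G).weight R₂ : ℝ) / r.factorial)
    rw [← hqR] at h2
    filter_upwards [h2.eventually (lt_mem_nhds (sub_lt_self _ hδ))] with t ht
    exact ht.le
  have hsize : ∀ R ∈ s, ∀ᶠ t in atTop, 2 * R.1 < a * m + d * t := fun R _ => by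
    filter_upwards [eventually_gt_atTop (2 * R.1)] with t ht
    nlinarith
  obtain ⟨T, hT⟩ := eventually_atTop.1 (((s.eventually_all.2 hpoint).and
    (s.eventually_all.2 hsize)).and (hcpos.and (eventually_gt_atTop 0)))
  refine ⟨a * m + d * T, fun n hn hmod => ?_⟩
  obtain ⟨t, rfl⟩ : ∃ t, n = a * m + d * t := by
    have h2 : a * m ≤ n := le_trans (Nat.le_add_right _ _) hn
    obtain ⟨t, ht⟩ := (Nat.modEq_iff_dvd' h2).1 hmod.symm
    exact ⟨t, by omega⟩
  obtain ⟨⟨hpt, hst⟩, hct, ht0⟩ :=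
    hT t (Nat.le_of_mul_le_mul_left (Nat.le_of_add_le_add_left hn) hd)
  refine ⟨by positivity, hct, hsδ _ fun R hR => ?_⟩
  rw [F.toReal_remainderLaw_apply G _ hct R (hst R hR)]
  exact hpt R hR
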